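/- **Setting.** Let $\tau\in(0,1)$, let $\mathcal T$ be a compact interval of positive length, $\rho_\tau(e)=[\tau-\mathbf 1\{e\le 0\}]e$, and let $(Y_i,X_i)$, $i=0,1,2,\dots$, be i.i.d., where $Y_i$ is real and $X_i$ is a random function on $\mathcal T$ with $E X_i(t)^2<\infty$ for $t\in\mathcal T$, $\int_{\mathcal T}E X_i(t)^2dt<\infty$ and mean function $\mu$. Assume $Y_i=Q_\tau(X_i)+\varepsilon_i$ with $Q_\tau(X_i)=a+\int_{\mathcal T}b(t)\{X_i(t)-\mu(t)\}dt$, $b\in L_2(\mathcal T)$, $P(\varepsilon_i\le 0\mid X_i)=\tau$ a.s., $E|\varepsilon_i|<\infty$. In the sample of size $n$ one observes $\mathcal D_n=\{(Y_i,T_{il},U_{il}):1\le l\le N_i,\,1\le i\le n\}$, $U_{il}=X_i(T_{il})+\epsilon_{il}$, with i.i.d. mean-zero, finite-variance errors $\epsilon_{il}$ independent of $X_i$. The observation schemes $(N_i,T_{il})$ may depend on $n$ and $i$; $N_i$ and $T_{il}$ are functions of random elements $d_i$, which also carry the errors $\epsilon_{il}$, such that $(Y_i,X_i,d_i)$ are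 i.i.d. and, given $X_i$, the conditional law of $\varepsilon_i$ does not change when one also conditions on $d_i$. Unit $0$ is the new unit, observed in the same way. **Method.** From the data one forms estimates $\widehat\mu$, $\widehat G(s,t)=\sum_j\widehat\kappa_j\widehat\phi_j(s)\widehat\phi_j(t)$ (in $L_2(\mathcal T\times\mathcal T)$, $\widehat\kappa_1\ge\widehat\kappa_2\ge\dots\ge 0$, $\widehat\phi_j$ orthonormal in $L_2(\mathcal T)$) and $\widehat\sigma_u^2$, by any data-based first-stage procedure such as local linear smoothing. For a curve observed at $T_{i1},\dots,T_{iN_i}$ let $\widehat\xi_{ij}=\widehat\kappa_j\widehat{\boldsymbol\phi}_{ij}^\top\widehat\Sigma_{U_i}^{-1}(\mathbf U_i-\widehat{\boldsymbol\mu}_i)$, with $\widehat{\boldsymbol\phi}_{ij}=(\widehat\phi_j(T_{il}))_l$, $\widehat{\boldsymbol\mu}_i=(\widehat\mu(T_{il}))_l$, $\widehat\Sigma_{U_i}=(\widehat G(T_{il},T_{il'})+\widehat\sigma_u^2\delta_{ll'})_{l,l'}$, and let $\widehat X_{i,J}=\widehat\mu+\sum_{j\le J}\widehat\xi_{ij}\widehat\phi_j$.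 Let $(\widehat a_J,\widehat b_{1,J},\dots,\widehat b_{J,J})$ minimize $\sum_{i=1}^n\rho_\tau(Y_i-a-\sum_{j\le J}b_j\widehat\xi_{ij})$ and put $\widehat b_J=\sum_{j\le J}\widehat b_{j,J}\widehat\phi_j$. For finite nonempty non-random candidate sets $\mathcal J=\mathcal J^{(n)}\subset\mathbb N$ let $\mathcal W=\{\mathbf w\in[0,\infty)^{\mathcal J}:\sum_{J\in\mathcal J}w_J=1\}$, and put $\widehat Q_\tau(X_i,\mathbf w)=\sum_{J\in\mathcal J}w_J\big[\widehat a_J+\int_{\mathcal T}\widehat b_J(t)\{\widehat X_{i,J}(t)-\widehat\mu(t)\}dt\big]$. Let $2\le K=K_n\le n$, $M=\lfloor n/K\rfloor$; the $k$-th group is $\{(k-1)M+1,\dots,kM\}$, and $\widehat Q^{[-k]}_\tau(X_i,\mathbf w)$ is defined like $\widehat Q_\tau(X_i,\mathbf w)$ with $\widehat a_J,\widehat b_J$ computed without the $k$-th group (but $\widehat X_{i,J},\widehat\mu$ from all data). Let $\widehat{\mathbf w}$ minimize over $\mathcal W$ the criterion $\mathrm{CV}_K(\mathbf w)=\frac1n\sum_{k=1}^K\sum_{m=1}^M\rho_\tau\big(Y_{(k-1)M+m}-\widehat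 Q_\tau^{[-k]}(X_{(k-1)M+m},\mathbf w)\big)$. Let $\mathrm{FPE}_n(\mathbf w)=E\{\rho_\tau(Y_0-\widehat Q_\tau(X_0,\mathbf w))\mid\mathcal D_n\}$. **Conditions.** 1. There are constants $a_J^*$, functions $b_J^*$ and random functions $X^*_{i,J}$ (for each $n$ and $J$ a measurable functional, the same for all $i$, of $(X_i,d_i)$; all these limits may depend on $n$) and $c_n\ge0$, $c_n\to0$, such that $\widehat a_J-a_J^*$, $\widehat b_J(t)-b_J^*(t)$, $\widehat\mu(t)-\mu(t)$, $\widehat X_{i,J}(t)-X_{i,J}^*(t)$ and $E\{|\widehat X_{0,J}(t)-X^*_{0,J}(t)|\mid\mathcal D_n\}$ are $O_p(c_n)$ uniformly in $t\in\mathcal T$, $J\in\mathcal J$, $1\le i\le n$. The limits are bounded in mean: for some $B<\infty$ and all large $n$, $\max_{J\in\mathcal J}\int_{\mathcal T}|b_J^*(t)|dt\le B$ and $E\max_{J\in\mathcal J}\int_{\mathcal T}|X_{0,J}^*(t)-\mu(t)|dt\le B$. 2. There is $\varrho>0$ with $|Q^*_{\tau,J}(X_i)-Q_\tau(X_i)|\le\varrho$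 a.s. for all $n$, $0\le i\le n$, $J\in\mathcal J$, where $Q^*_{\tau,J}(X_i)=a_J^*+\int_{\mathcal T}b_J^*(t)\{X^*_{i,J}(t)-\mu(t)\}dt$. 3. There is $g_n\ge0$, $g_n\to0$, with $\widehat Q_\tau(X_{(k-1)M+m},\mathbf w)-\widehat Q_\tau^{[-k]}(X_{(k-1)M+m},\mathbf w)=O_p(g_n)$ uniformly in $\mathbf w\in\mathcal W$, $1\le k\le K$, $1\le m\le M$. **Corollary 1.** If Conditions 1–3 hold and $|\mathcal J|/n\to0$ as $n\to\infty$, then $$\frac{\mathrm{FPE}_n(\widehat{\mathbf w})}{\inf_{\mathbf w\in\mathcal W}\mathrm{FPE}_n(\mathbf w)}=1+O_p\big(c_n+g_n+n^{-1/2}|\mathcal J|^{1/2}\big)=1+o_p(1).$$ -/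

import Mathlib

open MeasureTheory ProbabilityTheory Filter Topology
open scoped ENNReal

noncomputable section

namespace FLQR

/-! ### Stochastic order symbols -/

/-- `Z n i = O_p(r n)` uniformly over the index `i : ι n`: for every `ε > 0` there is a constant `C`
such that, for all large `n`, with (outer) probability at most `ε` some `‖Z n i‖` exceeds
`C * r n`. -/
def UnifBigOp {Ω : Type*} [MeasurableSpace Ω] (P : Measure Ω) {E : Type*} [ENorm E]
    {ι : ℕ → Type*} (Z : (n : ℕ) → ι n → Ω → E) (r : ℕ → ℝ) : Prop :=
  ∀ ε : ℝ, 0 < ε → ∃ C : ℝ, 0 < C ∧ ∀ᶠ n in atTop,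
    P {ω | ∃ i : ι n, ENNReal.ofReal (C * r n) < ‖Z n i ω‖ₑ} ≤ ENNReal.ofReal ε

/-- `Z n = O_p(r n)`. -/
def BigOp {Ω : Type*} [MeasurableSpace Ω] (P : Measure Ω) (Z : ℕ → Ω → ℝ) (r : ℕ → ℝ) : Prop :=
  UnifBigOp P (ι := fun _ => Unit) (fun n _ ω => Z n ω) r

/-- The check function `ρ_τ(e) = (τ - 1{e ≤ 0}) e`. -/
def check (τ e : ℝ) : ℝ := (τ - if e ≤ 0 then 1 else 0) * e

/-! ### Observed data -/

/-- The discrete noisy observations `(T_l, U_l)`, `l = 1, …, N`, of one curve. -/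
structure CurveObs where
  N : ℕ
  T : Fin N → ℝ
  U : Fin N → ℝ

/-- The observed sample `D_n`: for each unit, the response and the curve observations. -/
abbrev Sample (n : ℕ) : Type := Fin n → ℝ × CurveObs

/-! ### Functional principal components analysis -/

/-- Output of the first estimation stage: mean function, covariance function, eigenvalues and
eigenfunctions (`eigval j`, `eigfun j` with `j = 0, 1, …`), measurement error variance. -/
structure FPCAFit where
  mean : ℝ → ℝ
  cov : ℝ → ℝ → ℝ
  eigval : ℕ → ℝ
  eigfun : ℕ → ℝ → ℝ
  noiseVar : ℝ

namespace FPCAFit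

/-- `eigval`, `eigfun` form the spectral decomposition
`G(s,t) = ∑ⱼ κⱼ φⱼ(s) φⱼ(t)` in `L₂(I × I)` of the covariance estimate `cov`, with
`κ₁ ≥ κ₂ ≥ … ≥ 0` and orthonormal `φⱼ`. -/
structure IsFPCA (f : FPCAFit) (I : Set ℝ) : Prop where
  mean_meas : Measurable f.mean
  cov_meas : Measurable (Function.uncurry f.cov)
  eigfun_meas : ∀ j, Measurable (f.eigfun j)
  eigval_antitone : Antitone f.eigval
  eigval_nonneg : ∀ j, 0 ≤ f.eigval j
  eigfun_memLp : ∀ j, MemLp (f.eigfun j) 2 (volume.restrict I)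
  orthonormal : ∀ j k, ∫ t in I, f.eigfun j t * f.eigfun k t = if j = k then 1 else 0
  spectral : Tendsto
    (fun m : ℕ => ∫⁻ s in I, ∫⁻ t in I,
      ‖f.cov s t - ∑ j ∈ Finset.range m, f.eigval j * f.eigfun j s * f.eigfun j t‖ₑ ^ 2)
    atTop (𝓝 0)

/-- The matrix `Ĝ(T_l, T_l') + σ̂_u² δ_{ll'}`. -/
def obsCov (f : FPCAFit) (o : CurveObs) : Matrix (Fin o.N) (Fin o.N) ℝ :=
  Matrix.of fun l l' => f.cov (o.T l) (o.T l') + if l = l' then f.noiseVar else 0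

/-- The score estimate by conditional expectation (PACE),
`ξ̂ⱼ = κ̂ⱼ φ̂ⱼᵀ Σ̂_U⁻¹ (U - μ̂)`. -/
def score (f : FPCAFit) (o : CurveObs) (j : ℕ) : ℝ :=
  f.eigval j * ((fun l => f.eigfun j (o.T l)) ⬝ᵥ
    Matrix.mulVec (f.obsCov o)⁻¹ (fun l => o.U l - f.mean (o.T l)))

/-- The reconstructed curve `X̂_J(t) = μ̂(t) + ∑_{j ≤ J} ξ̂ⱼ φ̂ⱼ(t)`. -/
def curve (f : FPCAFit) (o : CurveObs) (J : ℕ) (t : ℝ) : ℝ :=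
  f.mean t + ∑ j ∈ Finset.range J, f.score o j * f.eigfun j t

end FPCAFit

/-- The quantile regression criterion
`∑_{i ∈ A} ρ_τ(Y_i - a - ∑_{j ≤ J} b_j ξ̂_{ij})` over the units in `A`. -/
def qrLoss {n : ℕ} (τ : ℝ) (f : FPCAFit) (D : Sample n) (A : Finset (Fin n)) (J : ℕ)
    (p : ℝ × (Fin J → ℝ)) : ℝ :=
  ∑ i ∈ A, check τ ((D i).1 - p.1 - ∑ j : Fin J, p.2 j * f.score (D i).2 j)

/-! ### Folds -/

/-- The `m`-th unit of the `k`-th group, both counted from `0`; all groups have size `⌊n/K⌋`. -/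
def foldIdx {n K : ℕ} (k : Fin K) (m : Fin (n / K)) : Fin n :=
  ⟨k * (n / K) + m, by
    have h1 : (k : ℕ) + 1 ≤ K := k.2
    have h2 : (m : ℕ) < n / K := m.2
    calc (k : ℕ) * (n / K) + m < (k : ℕ) * (n / K) + n / K := by omega
      _ = ((k : ℕ) + 1) * (n / K) := by ring
      _ ≤ K * (n / K) := Nat.mul_le_mul_right _ h1
      _ ≤ n := Nat.mul_div_le n K⟩

/-- All units outside the `k`-th group. -/
def leaveOut (n : ℕ) {K : ℕ} (k : Fin K) : Finset (Fin n) :=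
  Finset.univ.filter fun i => ∀ m : Fin (n / K), i ≠ foldIdx k m

/-! ### Estimators -/

/-- All estimators, as functions of the observed sample. The argument `A` is the set of units from
which an estimate is computed: `Finset.univ` for the full sample, `leaveOut n k` in the `k`-th step
of cross-validation. The first stage `fpca` is an arbitrary functional of the data (for instance
local linear smoothing and spectral decomposition); whether it is recomputed without the left-out
group or taken from the full sample is left open. -/
structure Estimators (𝒥 : ℕ → Finset ℕ) where
  fpca : (n : ℕ) → Sample n → Finset (Fin n) → FPCAFit
  icept : (n : ℕ) → Sample n → Finset (Fin n) → ℕ → ℝ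
  coef : (n : ℕ) → Sample n → Finset (Fin n) → (J : ℕ) → Fin J → ℝ
  weight : (n : ℕ) → Sample n → (𝒥 n → ℝ)

namespace Estimators

variable {𝒥 : ℕ → Finset ℕ}

/-- `b̂_J(t) = ∑_{j ≤ J} b̂_{j,J} φ̂ⱼ(t)`. -/
def slope (m : Estimators 𝒥) {n : ℕ} (D : Sample n) (A : Finset (Fin n)) (J : ℕ) (t : ℝ) : ℝ :=
  ∑ j : Fin J, m.coef n D A J j * (m.fpca n D A).eigfun j t

/-- The prediction `â_J + ∫_I b̂_J(t) (X̂_J(t) - μ̂(t)) dt` for a curve observed through `o`. The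
intercept and the slope are computed from the units in `A`; `X̂_J` and `μ̂` always come from the
full sample. -/
def pred (m : Estimators 𝒥) (I : Set ℝ) {n : ℕ} (D : Sample n) (A : Finset (Fin n)) (J : ℕ)
    (o : CurveObs) : ℝ :=
  m.icept n D A J + ∫ t in I, m.slope D A J t *
    ((m.fpca n D Finset.univ).curve o J t - (m.fpca n D Finset.univ).mean t)

/-- The model averaging prediction with weights `w`. -/
def avgPred (m : Estimators 𝒥) (I : Set ℝ) {n : ℕ} (D : Sample n) (A : Finset (Fin n))
    (w : 𝒥 n → ℝ) (o : CurveObs) : ℝ :=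
  ∑ J : 𝒥 n, w J * m.pred I D A J o

/-- The `K`-fold cross-validation criterion. -/
def cv (m : Estimators 𝒥) (I : Set ℝ) (τ : ℝ) {n : ℕ} (K : ℕ) (D : Sample n)
    (w : 𝒥 n → ℝ) : ℝ :=
  (1 / (n : ℝ)) * ∑ k : Fin K, ∑ i : Fin (n / K),
    check τ ((D (foldIdx k i)).1 - m.avgPred I D (leaveOut n k) w (D (foldIdx k i)).2)

/-- The estimators are those of the method: spectral decomposition in the first stage, quantile
regression on the estimated scores in the second, cross-validated weights in the third. -/
structure IsMethod (m : Estimators 𝒥) (I : Set ℝ) (τ : ℝ) (K : ℕ → ℕ) : Prop where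
  fpca : ∀ n D A, (m.fpca n D A).IsFPCA I
  qr : ∀ n D A J, ∀ p : ℝ × (Fin J → ℝ),
    qrLoss τ (m.fpca n D A) D A J (m.icept n D A J, m.coef n D A J)
      ≤ qrLoss τ (m.fpca n D A) D A J p
  weight_mem : ∀ n D, m.weight n D ∈ stdSimplex ℝ (𝒥 n)
  weight_min : ∀ n D, ∀ w ∈ stdSimplex ℝ (𝒥 n),
    m.cv I τ (K n) D (m.weight n D) ≤ m.cv I τ (K n) D w

end Estimators

/-! ### The functional linear quantile regression model -/

/-- The ingredients of the model. Unit `0` is the new unit, units `1, …, n` form the sample. The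
covariate of unit `i` is a random element `x i` of a measurable space `S` of functions, `ev` being
evaluation. The random element `d i` carries the measurement errors `noise (d i) l` and the
possibly random observation scheme: in a sample of size `n`, unit `i` is observed at the points
`T n i (d i) l`, `l < N n i (d i)`. -/
structure Model (Ω S D : Type*) where
  lo : ℝ
  hi : ℝ
  τ : ℝ
  a : ℝ
  b : ℝ → ℝ
  ev : S → ℝ → ℝ
  Y : ℕ → Ω → ℝ
  x : ℕ → Ω → S
  d : ℕ → Ω → D
  noise : D → ℕ → ℝ
  N : ℕ → ℕ → D → ℕ
  T : ℕ → ℕ → D → ℕ → ℝ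

namespace Model

variable {Ω S D : Type*}

/-- The compact interval on which the curves live. -/
def I (M : Model Ω S D) : Set ℝ := Set.Icc M.lo M.hi

/-- The random function `X_i(t)`. -/
def X (M : Model Ω S D) (i : ℕ) (ω : Ω) (t : ℝ) : ℝ := M.ev (M.x i ω) t

/-- The mean function `μ(t) = E X(t)`. -/
def mu [MeasurableSpace Ω] (M : Model Ω S D) (P : Measure Ω) (t : ℝ) : ℝ := ∫ ω, M.X 0 ω t ∂P

/-- `Q_τ(X_i) = a + ∫_I b(t) (X_i(t) - μ(t)) dt`. -/
def Q [MeasurableSpace Ω] (M : Model Ω S D) (P : Measure Ω) (i : ℕ) (ω : Ω) : ℝ :=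
  M.a + ∫ t in M.I, M.b t * (M.X i ω t - M.mu P t)

/-- `ε_i = Y_i - Q_τ(X_i)`. -/
def eps [MeasurableSpace Ω] (M : Model Ω S D) (P : Measure Ω) (i : ℕ) (ω : Ω) : ℝ :=
  M.Y i ω - M.Q P i ω

/-- The observations `(T_{il}, U_{il})`, `U_{il} = X_i(T_{il}) + ϵ_{il}`, of the curve of unit `i`
in a sample of size `n`. -/
def obs (M : Model Ω S D) (n i : ℕ) (ω : Ω) : CurveObs where
  N := M.N n i (M.d i ω)
  T := fun l => M.T n i (M.d i ω) l
  U := fun l => M.X i ω (M.T n i (M.d i ω) l) + M.noise (M.d i ω) l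

/-- The observed sample `D_n`. -/
def sample (M : Model Ω S D) (n : ℕ) (ω : Ω) : Sample n :=
  fun i => (M.Y (i + 1) ω, M.obs n (i + 1) ω)

/-- The functional linear quantile regression model with an i.i.d. sample and an independent
copy. -/
structure IsFLQR [MeasurableSpace Ω] [MeasurableSpace S] [MeasurableSpace D]
    (M : Model Ω S D) (P : Measure Ω) : Prop where
  lo_lt_hi : M.lo < M.hi
  tau_pos : 0 < M.τ
  tau_lt_one : M.τ < 1
  b_meas : Measurable M.b
  b_memLp : MemLp M.b 2 (volume.restrict M.I)
  ev_meas : Measurable (Function.uncurry M.ev)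
  Y_meas : ∀ i, Measurable (M.Y i)
  x_meas : ∀ i, Measurable (M.x i)
  d_meas : ∀ i, Measurable (M.d i)
  noise_meas : ∀ l, Measurable fun δ => M.noise δ l
  N_meas : ∀ n i, Measurable (M.N n i)
  T_meas : ∀ n i l, Measurable fun δ => M.T n i δ l
  T_mem : ∀ n i δ l, l < M.N n i δ → M.T n i δ l ∈ M.I
  indep : iIndepFun (fun i ω => (M.Y i ω, M.x i ω, M.d i ω)) P
  ident : ∀ i, IdentDistrib (fun ω => (M.Y i ω, M.x i ω, M.d i ω))
    (fun ω => (M.Y 0 ω, M.x 0 ω, M.d 0 ω)) P P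
  X_memLp : ∀ t ∈ M.I, MemLp (fun ω => M.X 0 ω t) 2 P
  X_sq_int : ∫⁻ ω, (∫⁻ t in M.I, ‖M.X 0 ω t‖ₑ ^ 2) ∂P < ∞
  noise_indep : iIndepFun (fun l ω => M.noise (M.d 0 ω) l) P
  noise_ident : ∀ l, IdentDistrib (fun ω => M.noise (M.d 0 ω) l) (fun ω => M.noise (M.d 0 ω) 0) P P
  noise_memLp : MemLp (fun ω => M.noise (M.d 0 ω) 0) 2 P
  noise_mean : ∫ ω, M.noise (M.d 0 ω) 0 ∂P = 0
  noise_indep_x : IndepFun (M.x 0) (fun ω => M.noise (M.d 0 ω)) P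
  /-- `P(ε ≤ 0 | X) = τ`. -/
  quantile : P[Set.indicator {ω | M.eps P 0 ω ≤ 0} (fun _ => (1 : ℝ)) |
      MeasurableSpace.comap (M.x 0) inferInstance] =ᵐ[P] fun _ => M.τ
  /-- The way a curve is observed carries no information on `ε` beyond that in `X`. -/
  cond_indep : ∀ s : ℝ,
    P[Set.indicator {ω | M.eps P 0 ω ≤ s} (fun _ => (1 : ℝ)) |
        MeasurableSpace.comap (fun ω => (M.x 0 ω, M.d 0 ω)) inferInstance]
      =ᵐ[P] P[Set.indicator {ω | M.eps P 0 ω ≤ s} (fun _ => (1 : ℝ)) |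
        MeasurableSpace.comap (M.x 0) inferInstance]
  /-- `E ρ_τ(ε)` is finite. -/
  eps_int : Integrable (M.eps P 0) P

/-- The final prediction error `E{ρ_τ(Y_0 - Q̂_τ(X_0, w)) | D_n}`. Unit `0` is independent of `D_n`
and the estimators are functions of `D_n`, so that the conditional expectation is the integral over
unit `0` with `D_n = sample n ω` held fixed. -/
def FPE [MeasurableSpace Ω] (M : Model Ω S D) (P : Measure Ω) {𝒥 : ℕ → Finset ℕ}
    (m : Estimators 𝒥) (n : ℕ) (ω : Ω) (w : 𝒥 n → ℝ) : ℝ≥0∞ :=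
  ∫⁻ ω', ENNReal.ofReal (check M.τ
    (M.Y 0 ω' - m.avgPred M.I (M.sample n ω) Finset.univ w (M.obs n 0 ω'))) ∂P

/-- `FPE_n(ŵ) / inf_w FPE_n(w)`. -/
def FPEratio [MeasurableSpace Ω] (M : Model Ω S D) (P : Measure Ω) {𝒥 : ℕ → Finset ℕ}
    (m : Estimators 𝒥) (n : ℕ) (ω : Ω) : ℝ :=
  (M.FPE P m n ω (m.weight n (M.sample n ω)) /
    ⨅ w ∈ stdSimplex ℝ (𝒥 n), M.FPE P m n ω w).toReal

end Model

/-! ### Conditions -/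

/-- The limits `a*_J`, `b*_J(t)`, `X*_{i,J}(t)` of the estimators (arguments `n`, `J`; they may
depend on `n`). `X*_{i,J}` is one functional `X n J`, the same for all units, of the covariate and
the observation scheme of unit `i`. -/
structure Limits (S D : Type*) where
  a : ℕ → ℕ → ℝ
  b : ℕ → ℕ → ℝ → ℝ
  X : ℕ → ℕ → S × D → ℝ → ℝ

section Conditions

variable {Ω S D : Type*} [MeasurableSpace Ω] [MeasurableSpace S] [MeasurableSpace D]

/-- `X*_{i,J}(t)`. -/
def Limits.curve (L : Limits S D) (M : Model Ω S D) (n J i : ℕ) (ω : Ω) (t : ℝ) : ℝ :=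
  L.X n J (M.x i ω, M.d i ω) t

/-- `Q*_{τ,J}(X_i) = a*_J + ∫_I b*_J(t) (X*_{i,J}(t) - μ(t)) dt`. -/
def Limits.Q (L : Limits S D) (M : Model Ω S D) (P : Measure Ω) (n J i : ℕ) (ω : Ω) : ℝ :=
  L.a n J + ∫ t in M.I, L.b n J t * (L.curve M n J i ω t - M.mu P t)

/-- The limit functions are measurable, the `b*_J` are bounded in `L₁` and the `X*_{0,J} - μ` have
an `L₁`-envelope over the candidate set with bounded expectation, for all large `n`. -/
structure Limits.Regular (L : Limits S D) (M : Model Ω S D) (P : Measure Ω)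
    (𝒥 : ℕ → Finset ℕ) : Prop where
  b_meas : ∀ n J, Measurable (L.b n J)
  X_meas : ∀ n J, Measurable (Function.uncurry (L.X n J))
  b_bound : ∃ B : ℝ, ∀ᶠ n in atTop, ∀ J ∈ 𝒥 n,
    ∫⁻ t in M.I, ‖L.b n J t‖ₑ ≤ ENNReal.ofReal B
  X_bound : ∃ B : ℝ, ∀ᶠ n in atTop,
    ∫⁻ ω, (⨆ J ∈ 𝒥 n, ∫⁻ t in M.I, ‖L.curve M n J 0 ω t - M.mu P t‖ₑ) ∂P ≤ ENNReal.ofReal B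

/-- Convergence of the estimators to their limits at rate `c n`, uniformly in `t ∈ I`, `J ∈ 𝒥 n`
and `i ∈ {1, …, n}`. As in the final prediction error, the conditional expectation given `D_n` is
the integral over unit `0`. -/
structure Condition1 (M : Model Ω S D) (P : Measure Ω) {𝒥 : ℕ → Finset ℕ} (m : Estimators 𝒥)
    (L : Limits S D) (c : ℕ → ℝ) : Prop where
  rate_nonneg : ∀ n, 0 ≤ c n
  rate_tendsto : Tendsto c atTop (𝓝 0)
  icept : UnifBigOp P (ι := fun n => 𝒥 n)
    (fun n J ω => m.icept n (M.sample n ω) Finset.univ J - L.a n J) c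
  slope : UnifBigOp P (ι := fun n => 𝒥 n × M.I)
    (fun n p ω => m.slope (M.sample n ω) Finset.univ p.1 p.2 - L.b n p.1 p.2) c
  mean : UnifBigOp P (ι := fun _ => M.I)
    (fun n t ω => (m.fpca n (M.sample n ω) Finset.univ).mean t - M.mu P t) c
  curve : UnifBigOp P (ι := fun n => 𝒥 n × M.I × Fin n)
    (fun n p ω => (m.fpca n (M.sample n ω) Finset.univ).curve (M.obs n (p.2.2 + 1) ω) p.1 p.2.1
      - L.curve M n p.1 (p.2.2 + 1) ω p.2.1) c
  curve_new : UnifBigOp P (ι := fun n => 𝒥 n × M.I)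
    (fun n p ω => ∫⁻ ω', ‖(m.fpca n (M.sample n ω) Finset.univ).curve (M.obs n 0 ω') p.1 p.2
      - L.curve M n p.1 0 ω' p.2‖ₑ ∂P) c

/-- `|Q*_{τ,J}(X_i) - Q_τ(X_i)| ≤ ϱ` a.s., uniformly in `i ∈ {0, …, n}` and `J ∈ 𝒥 n`. -/
def Condition2 (M : Model Ω S D) (P : Measure Ω) (𝒥 : ℕ → Finset ℕ) (L : Limits S D) : Prop :=
  ∃ ϱ : ℝ, 0 < ϱ ∧ ∀ n, ∀ i ≤ n, ∀ J ∈ 𝒥 n, ∀ᵐ ω ∂P, |L.Q M P n J i ω - M.Q P i ω| ≤ ϱ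

/-- The full-sample and the leave-one-group-out predictions of the left-out units differ by
`O_p(g n)`, uniformly over the weights and the units. -/
structure Condition3 (M : Model Ω S D) (P : Measure Ω) {𝒥 : ℕ → Finset ℕ} (m : Estimators 𝒥)
    (K : ℕ → ℕ) (g : ℕ → ℝ) : Prop where
  rate_nonneg : ∀ n, 0 ≤ g n
  rate_tendsto : Tendsto g atTop (𝓝 0)
  diff : UnifBigOp P (ι := fun n => stdSimplex ℝ (𝒥 n) × Fin (K n) × Fin (n / K n))
    (fun n p ω =>
      m.avgPred M.I (M.sample n ω) Finset.univ p.1 (M.sample n ω (foldIdx p.2.1 p.2.2)).2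
      - m.avgPred M.I (M.sample n ω) (leaveOut n p.2.1) p.1
          (M.sample n ω (foldIdx p.2.1 p.2.2)).2) g

end Conditions

end FLQR

end

/-!
The ratio exceeds `1` by `(FPE(ŵ) - inf FPE) / inf FPE`. Given covariate and observation scheme,
`Q_τ` is a `τ`-quantile of the response, so by the subgradient inequality of the check function
every prediction error is at least `κ = E ρ_τ(ε)`, which is positive (`integral_check_eps_le`,
`integral_check_eps_pos`). It remains to bound `FPE(ŵ) - inf FPE`, which is a comparison of both the
prediction error and the cross-validation criterion with the risk of the limit prediction
`Q*_w = ∑ w_J Q*_{τ,J}`, uniformly in the weights.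

* Replacing predictions by their limits costs `O(c)`. The slope error is integrated against the
  curves, whose `L₁`-norms are controlled by the envelope of the limit curves, and the curve error
  is integrated against the limit slope (`enorm_integral_mul_sub_le`). For the new unit the bound
  holds in expectation (`FPE_close`); for the sampled units it holds on average, by Markov's
  inequality for the envelopes (`sum_abs_avgPred_sub_le`, `measure_sum_envelope_le`). Leaving out a
  group costs `O(g)` (`abs_cv_sub_le`).
* The excess losses `ρ_τ(ε_i - u) - ρ_τ(ε_i)` at `u = ∑ w_J (Q*_{τ,J} - Q_τ)(X_i)` have sums over
  the units that deviate from their expectations by `O_p(√(n |𝒥|))`, uniformly over the simplex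
  (`measure_exists_simplex_le`). Since the loss is `1`-Lipschitz in `u`, symmetrization and
  contraction reduce the expected maximum over a finite net to that of signed sums that are linear
  in `w`, hence to `|𝒥|` second moments. Symmetrization and contraction are done together, one
  observation at a time (`integral_iSup_centered_le`), and tensorized by Fubini's theorem
  (`integral_iSup_sum_le`).

The losses `ρ_τ(ε_i)` are common to all weights and drop out when `ŵ` is compared with a competitor,
so their fluctuations play no role. At a fixed sample point the argument is deterministic
(`abs_FPEratio_sub_one_le`), and no measurability of the estimators in the sample is needed: all
exceptional events are covered in outer measure.
-/

namespace FLQR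

/-! ### Symmetrization and contraction for finite families -/

lemma integral_pi_succ {V : Type*} [MeasurableSpace V] (ν : Measure V) [IsProbabilityMeasure ν] {N : ℕ}
    {F : V → (Fin N → V) → ℝ}
    (hF : Integrable (Function.uncurry F) (ν.prod (Measure.pi fun _ => ν))) :
    ∫ v : Fin (N + 1) → V, F (v 0) (fun i => v i.succ) ∂(Measure.pi fun _ => ν)
      = ∫ x, ∫ y, F x y ∂(Measure.pi fun _ => ν) ∂ν := by
  have h := (measurePreserving_piFinSuccAbove (fun _ : Fin (N + 1) => ν) 0).integral_comp'
    (g := Function.uncurry F)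
  exact h.trans (integral_prod _ hF)

section EmpiricalProcess

variable {W : Type*} [Finite W]

lemma le_iSup_of_finite (f : W → ℝ) (w : W) : f w ≤ ⨆ w, f w :=
  le_ciSup (Set.finite_range f).bddAbove w

variable [Nonempty W]

lemma abs_iSup_le_of_finite {f : W → ℝ} {C : ℝ} (h : ∀ w, |f w| ≤ C) : |⨆ w, f w| ≤ C := by
  obtain ⟨w, hw⟩ := exists_eq_ciSup_of_finite (f := f)
  rw [← hw]
  exact h w

/-- The contraction principle for one sign: for the maximizers `w`, `w'` on the left,
`h w - h w' ≤ |l w - l w'|`, and on the right one of the two assignments of `w`, `w'` to the two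
maxima attains this absolute value. -/
lemma iSup_add_iSup_le_of_contraction (A h l : W → ℝ)
    (hl : ∀ w w', |h w - h w'| ≤ |l w - l w'|) :
    (⨆ w, (A w / 2 + h w)) + ⨆ w, (A w / 2 - h w)
      ≤ 1 / 2 * ((⨆ w, (A w + 2 * l w)) + ⨆ w, (A w + -(2 * l w))) := by
  obtain ⟨w, hw⟩ := exists_eq_ciSup_of_finite (f := fun w => A w / 2 + h w)
  obtain ⟨w', hw'⟩ := exists_eq_ciSup_of_finite (f := fun w => A w / 2 - h w)
  rw [← hw, ← hw']
  have h1 := le_iSup_of_finite (fun w => A w + 2 * l w) w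
  have h2 := le_iSup_of_finite (fun w => A w + 2 * l w) w'
  have h3 := le_iSup_of_finite (fun w => A w + -(2 * l w)) w
  have h4 := le_iSup_of_finite (fun w => A w + -(2 * l w)) w'
  have h5 := (le_abs_self _).trans (hl w w')
  rcases abs_cases (l w - l w') with ⟨h6, _⟩ | ⟨h6, _⟩ <;> linarith

/-- The uniform distribution on `Bool`, the law of a random sign. -/
noncomputable def coin : Measure Bool :=
  ENNReal.ofReal (1 / 2) • Measure.dirac true + ENNReal.ofReal (1 / 2) • Measure.dirac false

/-- The sign attached to a coin toss. -/
def sgn (b : Bool) : ℝ := if b then 1 else -1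

instance : IsProbabilityMeasure coin := by
  constructor
  simp only [coin, Measure.add_apply, Measure.smul_apply, measure_univ, smul_eq_mul, mul_one]
  rw [← ENNReal.ofReal_add (by norm_num) (by norm_num)]
  norm_num

lemma integral_coin (f : Bool → ℝ) : ∫ b, f b ∂coin = 1 / 2 * (f true + f false) := by
  have hi : ∀ b, Integrable f (Measure.dirac b) := fun b => Integrable.of_finite
  rw [coin, integral_add_measure ((hi _).smul_measure (by simp))
    ((hi _).smul_measure (by simp)), integral_smul_measure, integral_smul_measure,
    integral_dirac, integral_dirac]
  simp
  ring

lemma abs_sgn (b : Bool) : |sgn b| = 1 := by cases b <;> simp [sgn]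

lemma measurable_sgn : Measurable sgn := measurable_of_finite _

variable {V V' : Type*} [MeasurableSpace V] [MeasurableSpace V']

lemma integrable_iSup {μ : Measure V} [IsFiniteMeasure μ] {f : W → V → ℝ} {C : ℝ}
    (hf : ∀ w, Measurable (f w)) (hb : ∀ w v, |f w v| ≤ C) :
    Integrable (fun v => ⨆ w, f w v) μ :=
  Integrable.of_bound (Measurable.iSup hf).aestronglyMeasurable C
    (ae_of_all _ fun v => abs_iSup_le_of_finite fun w => hb w v)

/-- One symmetrization step. No ghost sample is needed: half of `A` is spent on `h`, the other half
on the expectation of `h`, which Jensen's inequality turns into an independent copy. -/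
lemma integral_iSup_centered_le (ν : Measure V) [IsProbabilityMeasure ν] {h l : W → V → ℝ}
    (hh : ∀ w, Measurable (h w)) (hl : ∀ w, Measurable (l w)) {C : ℝ}
    (hhC : ∀ w v, |h w v| ≤ C) (hlC : ∀ w v, |l w v| ≤ C)
    (hc : ∀ w w' v, |h w v - h w' v| ≤ |l w v - l w' v|) (A : W → ℝ) :
    ∫ v, ⨆ w, (A w + (h w v - ∫ x, h w x ∂ν)) ∂ν
      ≤ ∫ z, ⨆ w, (A w + sgn z.2 * (2 * l w z.1)) ∂(ν.prod coin) := by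
  obtain ⟨CA, hCA⟩ : ∃ CA, ∀ w, |A w| ≤ CA := by
    obtain ⟨CA, h⟩ := (Set.finite_range fun w => |A w|).bddAbove
    exact ⟨CA, fun w => h ⟨w, rfl⟩⟩
  have hint : ∀ w, Integrable (h w) ν := fun w =>
    Integrable.of_bound (hh w).aestronglyMeasurable C (ae_of_all _ fun v => hhC w v)
  have hE : ∀ w, |∫ x, h w x ∂ν| ≤ C := fun w => by
    have := norm_integral_le_of_norm_le_const (μ := ν) (f := h w) (ae_of_all _ fun v => hhC w v)
    simpa using this
  have i1 : Integrable (fun v => ⨆ w, (A w / 2 + h w v)) ν :=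
    integrable_iSup (C := CA / 2 + C) (fun w => (hh w).const_add _) fun w v => by
      have := hCA w; have := hhC w v
      rw [abs_le] at *; constructor <;> linarith
  have i2 : Integrable (fun v => ⨆ w, (A w / 2 - h w v)) ν :=
    integrable_iSup (C := CA / 2 + C) (fun w => (hh w).const_sub _) fun w v => by
      have := hCA w; have := hhC w v
      rw [abs_le] at *; constructor <;> linarith
  have i3 : Integrable (fun v => ⨆ w, (A w + (h w v - ∫ x, h w x ∂ν))) ν :=
    integrable_iSup (C := CA + (C + C)) (fun w => ((hh w).sub_const _).const_add _) fun w v => by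
      have := hCA w; have := hhC w v; have := hE w
      rw [abs_le] at *; constructor <;> linarith
  have hm : ∀ w, Measurable fun z : V × Bool => A w + sgn z.2 * (2 * l w z.1) := fun w =>
    ((measurable_sgn.comp measurable_snd).mul
      (((hl w).comp measurable_fst).const_mul 2)).const_add _
  have i4 : Integrable (fun z : V × Bool => ⨆ w, (A w + sgn z.2 * (2 * l w z.1)))
      (ν.prod coin) :=
    integrable_iSup (C := CA + 2 * C) hm fun w z => by
      refine (abs_add_le _ _).trans (add_le_add (hCA w) ?_)
      rw [abs_mul, abs_sgn, one_mul, abs_mul, abs_two]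
      exact mul_le_mul_of_nonneg_left (hlC _ _) zero_le_two
  have jensen : ⨆ w, (A w / 2 - ∫ x, h w x ∂ν) ≤ ∫ v, ⨆ w, (A w / 2 - h w v) ∂ν := by
    refine ciSup_le fun w => ?_
    have : A w / 2 - ∫ x, h w x ∂ν = ∫ x, (A w / 2 - h w x) ∂ν := by
      rw [integral_sub (integrable_const _) (hint w)]; simp
    rw [this]
    exact integral_mono ((integrable_const _).sub (hint w)) i2
      fun v => le_iSup_of_finite (fun w => A w / 2 - h w v) w
  calc ∫ v, ⨆ w, (A w + (h w v - ∫ x, h w x ∂ν)) ∂ν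
      ≤ ∫ v, ((⨆ w, (A w / 2 + h w v)) + ⨆ w, (A w / 2 - ∫ x, h w x ∂ν)) ∂ν := by
        refine integral_mono i3 (i1.add (integrable_const _)) fun v => ciSup_le fun w => ?_
        have h1 := le_iSup_of_finite (fun w => A w / 2 + h w v) w
        have h2 := le_iSup_of_finite (fun w => A w / 2 - ∫ x, h w x ∂ν) w
        dsimp only at h1 h2 ⊢
        linarith
    _ ≤ ∫ v, ((⨆ w, (A w / 2 + h w v)) + ⨆ w, (A w / 2 - h w v)) ∂ν := by
        rw [integral_add i1 (integrable_const _), integral_add i1 i2]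
        simpa using jensen
    _ ≤ ∫ v, ∫ b, ⨆ w, (A w + sgn b * (2 * l w v)) ∂coin ∂ν := by
        refine integral_mono (i1.add i2) i4.integral_prod_left fun v => ?_
        dsimp only
        rw [integral_coin]
        simpa [sgn] using
          iSup_add_iSup_le_of_contraction A (h · v) (l · v) fun w w' => hc w w' v
    _ = _ := (integral_prod _ i4).symm

lemma integrable_iSup_add_sum (ν : Measure V) [IsProbabilityMeasure ν]
    (ν' : Measure V') [IsProbabilityMeasure ν'] {g : W → V → ℝ} {l : W → V' → ℝ}
    (hg : ∀ w, Measurable (g w)) (hl : ∀ w, Measurable (l w)) {C : ℝ}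
    (hgC : ∀ w v, |g w v| ≤ C) (hlC : ∀ w v, |l w v| ≤ C) (N : ℕ) (A : W → ℝ) :
    Integrable (Function.uncurry fun (x : V) (y : Fin N → V') =>
      ⨆ w, (A w + (g w x + ∑ i, l w (y i)))) (ν.prod (Measure.pi fun _ => ν')) := by
  obtain ⟨CA, hCA⟩ : ∃ CA, ∀ w, |A w| ≤ CA := by
    obtain ⟨CA, h⟩ := (Set.finite_range fun w => |A w|).bddAbove
    exact ⟨CA, fun w => h ⟨w, rfl⟩⟩
  have sm : ∀ w, Measurable fun y : Fin N → V' => ∑ i, l w (y i) := fun w =>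
    Finset.measurable_sum _ fun i _ => (hl w).comp (measurable_pi_apply i)
  refine integrable_iSup (C := CA + (C + N * C))
    (f := fun w (z : V × (Fin N → V')) => A w + (g w z.1 + ∑ i, l w (z.2 i)))
    (fun w => (((hg w).comp measurable_fst).add ((sm w).comp measurable_snd)).const_add _)
    fun w z => (abs_add_le _ _).trans (add_le_add (hCA w)
      ((abs_add_le _ _).trans (add_le_add (hgC w _) ?_)))
  refine (Finset.abs_sum_le_sum_abs _ _).trans ?_
  refine (Finset.sum_le_sum fun i _ => hlC w (z.2 i)).trans ?_
  simp

/-- A comparison of expected maxima that holds for one observation and every offset `A` carries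
over to independent samples. -/
lemma integral_iSup_sum_le (ν : Measure V) [IsProbabilityMeasure ν]
    (ν' : Measure V') [IsProbabilityMeasure ν'] {g : W → V → ℝ} {l : W → V' → ℝ}
    (hg : ∀ w, Measurable (g w)) (hl : ∀ w, Measurable (l w)) {C : ℝ}
    (hgC : ∀ w v, |g w v| ≤ C) (hlC : ∀ w v, |l w v| ≤ C)
    (step : ∀ A : W → ℝ, ∫ v, ⨆ w, (A w + g w v) ∂ν ≤ ∫ z, ⨆ w, (A w + l w z) ∂ν')
    (N : ℕ) (A : W → ℝ) :
    ∫ v : Fin N → V, ⨆ w, (A w + ∑ i, g w (v i)) ∂(Measure.pi fun _ => ν)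
      ≤ ∫ z : Fin N → V', ⨆ w, (A w + ∑ i, l w (z i)) ∂(Measure.pi fun _ => ν') := by
  induction N generalizing A with
  | zero => simp
  | succ N ih =>
    have i1 := integrable_iSup_add_sum ν ν hg hg hgC hgC N A
    have i2 := integrable_iSup_add_sum ν' ν' hl hl hlC hlC N A
    have i3 := integrable_iSup_add_sum ν ν' hg hl hgC hlC N A
    simp only [Fin.sum_univ_succ]
    rw [integral_pi_succ ν i1, integral_pi_succ ν' i2]
    calc _ ≤ ∫ x, ∫ y : Fin N → V', ⨆ w, (A w + (g w x + ∑ i, l w (y i)))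
            ∂(Measure.pi fun _ => ν') ∂ν := by
          refine integral_mono i1.integral_prod_left i3.integral_prod_left fun x => ?_
          simpa only [add_assoc] using ih fun w => A w + g w x
      _ = ∫ y : Fin N → V', ∫ x, ⨆ w, (A w + (g w x + ∑ i, l w (y i))) ∂ν
            ∂(Measure.pi fun _ => ν') := integral_integral_swap i3
      _ ≤ ∫ y : Fin N → V', ∫ x, ⨆ w, (A w + (l w x + ∑ i, l w (y i))) ∂ν'
            ∂(Measure.pi fun _ => ν') := by
          refine integral_mono i3.integral_prod_right i2.integral_prod_right fun y => ?_
          simpa only [add_assoc, add_comm (∑ i, l _ (y i))] using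
            step fun w => A w + ∑ i, l w (y i)
      _ = _ := (integral_integral_swap i2).symm

end EmpiricalProcess

/-! ### A uniform deviation bound over the simplex -/

section Deviation

variable {V ι : Type*} [MeasurableSpace V] [Fintype ι]

/-- Hölder's inequality for the pair `ℓ₁`, `ℓ_∞`. -/
lemma abs_linear_le {δ : ι → ℝ} {ϱ : ℝ} (hδ : ∀ j, |δ j| ≤ ϱ) {w : ι → ℝ} :
    |∑ j, w j * δ j| ≤ (∑ j, |w j|) * ϱ := by
  rw [Finset.sum_mul]
  refine (Finset.abs_sum_le_sum_abs _ _).trans (Finset.sum_le_sum fun j _ => ?_)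
  rw [abs_mul]
  exact mul_le_mul_of_nonneg_left (hδ j) (abs_nonneg _)

/-- Second moment of a sum of independent signed bounded variables. -/
lemma integral_sq_sum_sgn_le (ν : Measure V) [IsProbabilityMeasure ν] {q : V → ℝ}
    (hq : Measurable q) {C : ℝ} (hC : ∀ v, |q v| ≤ C) (N : ℕ) :
    ∫ z : Fin N → V × Bool, (∑ i, sgn (z i).2 * q (z i).1) ^ 2
      ∂(Measure.pi fun _ => ν.prod coin) ≤ N * C ^ 2 := by
  set r : V × Bool → ℝ := fun z => sgn z.2 * q z.1 with hr
  have hrm : Measurable r := (measurable_sgn.comp measurable_snd).mul (hq.comp measurable_fst)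
  have hrC : ∀ z, |r z| ≤ C := fun z => by
    simp only [hr, abs_mul, abs_sgn, one_mul]
    exact hC _
  have hr2 : MemLp r 2 (ν.prod coin) :=
    MemLp.of_bound hrm.aestronglyMeasurable C (ae_of_all _ hrC)
  have hr0 : ∫ z, r z ∂(ν.prod coin) = 0 := by
    rw [integral_prod _ (hr2.integrable (by norm_num))]
    simp [integral_coin, hr, sgn]
  have hri : ∀ i : Fin N, MemLp (fun z : Fin N → V × Bool => r (z i)) 2
      (Measure.pi fun _ => ν.prod coin) := fun i =>
    hr2.comp_measurePreserving (measurePreserving_eval _ i)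
  have hmean : ∫ z : Fin N → V × Bool, (∑ i, fun z : Fin N → V × Bool => r (z i)) z
      ∂(Measure.pi fun _ => ν.prod coin) = 0 := by
    simp only [Finset.sum_apply]
    rw [integral_finsetSum _ fun i _ => (hri i).integrable (by norm_num)]
    refine Finset.sum_eq_zero fun i _ => ?_
    rw [← hr0, ← (measurePreserving_eval (fun _ : Fin N => ν.prod coin) i).map_eq,
      integral_map (measurable_pi_apply i).aemeasurable hrm.aestronglyMeasurable]
    simp [(measurePreserving_eval (fun _ : Fin N => ν.prod coin) i).map_eq]
  have hvar := variance_sum_pi (μ := fun _ : Fin N => ν.prod coin) (X := fun _ => r) fun _ => hr2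
  rw [variance_of_integral_eq_zero ((memLp_finsetSum' _ fun i _ => hri i).aemeasurable)
    hmean] at hvar
  simp only [Finset.sum_apply] at hvar
  rw [hvar, variance_of_integral_eq_zero hrm.aemeasurable hr0]
  simp only [Finset.sum_const, Finset.card_univ, Fintype.card_fin, nsmul_eq_mul]
  refine mul_le_mul_of_nonneg_left ?_ (Nat.cast_nonneg _)
  refine (integral_mono hr2.integrable_sq (integrable_const (C ^ 2)) fun z => ?_).trans (by simp)
  rw [← sq_abs (r z)]
  exact pow_le_pow_left₀ (abs_nonneg _) (hrC z) 2

/-- The expected maximum of a centered empirical process indexed by finitely many `L₁`-bounded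
weight vectors, for losses that are `1`-Lipschitz in a linear predictor. -/
lemma integral_iSup_empirical_le (ν : Measure V) [IsProbabilityMeasure ν] [Nonempty ι]
    {W : Type*} [Finite W] [Nonempty W] {δ : ι → V → ℝ} (hδ : ∀ j, Measurable (δ j)) {ϱ : ℝ}
    (hϱ : 0 < ϱ) (hδϱ : ∀ j v, |δ j v| ≤ ϱ) {φ : V → ℝ → ℝ}
    (hφ : Measurable (Function.uncurry φ)) (hφ0 : ∀ v, φ v 0 = 0)
    (hφl : ∀ v u u', |φ v u - φ v u'| ≤ |u - u'|) {wt : W → ι → ℝ} (hwt : ∀ a, ∑ j, |wt a j| ≤ 1)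
    {N : ℕ} (hN : 0 < N) :
    ∫ v : Fin N → V, ⨆ a, ∑ i, (φ (v i) (∑ j, wt a j * δ j (v i))
        - ∫ x, φ x (∑ j, wt a j * δ j x) ∂ν) ∂(Measure.pi fun _ => ν)
      ≤ 2 * ϱ * √(N * Fintype.card ι) := by
  set l : W → V → ℝ := fun a v => ∑ j, wt a j * δ j v with hl
  have hlm : ∀ a, Measurable (l a) := fun a =>
    Finset.measurable_sum _ fun j _ => (hδ j).const_mul _
  have hlC : ∀ a v, |l a v| ≤ ϱ := fun a v =>
    (abs_linear_le fun j => hδϱ j v).trans (mul_le_of_le_one_left hϱ.le (hwt a))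
  have hhm : ∀ a, Measurable fun v => φ v (l a v) := fun a => hφ.comp (measurable_id.prodMk (hlm a))
  have hhC : ∀ a v, |φ v (l a v)| ≤ ϱ := fun a v => by
    have := hφl v (l a v) 0
    rw [hφ0, sub_zero, sub_zero] at this
    exact this.trans (hlC a v)
  have hE : ∀ a, |∫ x, φ x (l a x) ∂ν| ≤ ϱ := fun a => by
    simpa using norm_integral_le_of_norm_le_const (μ := ν) (f := fun x => φ x (l a x))
      (ae_of_all _ fun v => hhC a v)
  have hstep := integral_iSup_sum_le ν (ν.prod coin)
    (g := fun a v => φ v (l a v) - ∫ x, φ x (l a x) ∂ν)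
    (l := fun a z => sgn z.2 * (2 * l a z.1)) (C := 2 * ϱ)
    (fun a => (hhm a).sub_const _)
    (fun a => (measurable_sgn.comp measurable_snd).mul
      (((hlm a).comp measurable_fst).const_mul 2))
    (fun a v => by
      refine (abs_sub _ _).trans ?_
      linarith [hhC a v, hE a])
    (fun a z => by
      rw [abs_mul, abs_sgn, one_mul, abs_mul, abs_two]
      exact mul_le_mul_of_nonneg_left (hlC _ _) zero_le_two)
    (fun A => integral_iSup_centered_le ν hhm hlm hhC hlC (fun a a' v => hφl v _ _) A) N 0
  simp only [Pi.zero_apply, zero_add] at hstep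
  refine hstep.trans ?_
  have hp : (0 : ℝ) < Fintype.card ι := by exact_mod_cast Fintype.card_pos
  have hN' : (0 : ℝ) < N := by exact_mod_cast hN
  set t := 2 * ϱ * √(N * Fintype.card ι) with ht
  have htpos : 0 < t := by positivity
  have hint : ∀ j, Integrable (fun z : Fin N → V × Bool =>
      (∑ i, sgn (z i).2 * (2 * δ j (z i).1)) ^ 2) (Measure.pi fun _ => ν.prod coin) := fun j => by
    refine Integrable.of_bound (C := (N * (2 * ϱ)) ^ 2) ?_ (ae_of_all _ fun z => ?_)
    · refine (Measurable.pow_const (Finset.measurable_sum _ fun i _ => ?_) 2).aestronglyMeasurable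
      exact (measurable_sgn.comp (measurable_snd.comp (measurable_pi_apply i))).mul
        (((hδ j).comp (measurable_fst.comp (measurable_pi_apply i))).const_mul 2)
    · rw [Real.norm_eq_abs, abs_pow]
      refine pow_le_pow_left₀ (abs_nonneg _) ?_ 2
      refine (Finset.abs_sum_le_sum_abs _ _).trans ?_
      refine (Finset.sum_le_sum (g := fun _ => 2 * ϱ) fun i _ => ?_).trans (by simp)
      rw [abs_mul, abs_sgn, one_mul, abs_mul, abs_two]
      exact mul_le_mul_of_nonneg_left (hδϱ _ _) zero_le_two
  have hsq : ∫ z : Fin N → V × Bool, ∑ j, (∑ i, sgn (z i).2 * (2 * δ j (z i).1)) ^ 2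
      ∂(Measure.pi fun _ => ν.prod coin) ≤ t ^ 2 := by
    rw [integral_finsetSum _ fun j _ => hint j]
    refine (Finset.sum_le_sum fun j _ => integral_sq_sum_sgn_le ν ((hδ j).const_mul 2)
      (C := 2 * ϱ) (fun v => ?_) N).trans (le_of_eq ?_)
    · rw [abs_mul, abs_two]
      exact mul_le_mul_of_nonneg_left (hδϱ _ _) zero_le_two
    · rw [ht, mul_pow (2 * ϱ) (√_), Real.sq_sqrt (by positivity), Finset.sum_const,
        Finset.card_univ, nsmul_eq_mul]
      ring
  calc _ ≤ ∫ z : Fin N → V × Bool,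
        ((∑ j, (∑ i, sgn (z i).2 * (2 * δ j (z i).1)) ^ 2) / (2 * t) + t / 2)
        ∂(Measure.pi fun _ => ν.prod coin) := by
        refine integral_mono (integrable_iSup (C := N * (2 * ϱ)) (fun a => ?_) fun a z => ?_)
          (((integrable_finsetSum _ fun j _ => hint j).div_const _).add (integrable_const _))
          fun z => ciSup_le fun a => ?_
        · exact Finset.measurable_sum _ fun i _ =>
            (measurable_sgn.comp (measurable_snd.comp (measurable_pi_apply i))).mul
              (((hlm a).comp (measurable_fst.comp (measurable_pi_apply i))).const_mul 2)
        · refine (Finset.abs_sum_le_sum_abs _ _).trans ?_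
          refine (Finset.sum_le_sum (g := fun _ => 2 * ϱ) fun i _ => ?_).trans (by simp)
          rw [abs_mul, abs_sgn, one_mul, abs_mul, abs_two]
          exact mul_le_mul_of_nonneg_left (hlC _ _) zero_le_two
        · -- `⟨w, S⟩ ≤ ‖w‖₁ ‖S‖_∞` and `‖S‖_∞ ≤ ‖S‖₂² / (2t) + t / 2`
          have hswap : ∑ i, sgn (z i).2 * (2 * l a (z i).1)
              = ∑ j, wt a j * ∑ i, sgn (z i).2 * (2 * δ j (z i).1) := by
            simp only [hl, Finset.mul_sum]
            rw [Finset.sum_comm]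
            refine Finset.sum_congr rfl fun j _ => Finset.sum_congr rfl fun i _ => by ring
          rw [hswap]
          refine (le_abs_self _).trans ((abs_linear_le fun j => ?_).trans
            (mul_le_of_le_one_left (by positivity) (hwt a)))
          set S : ι → ℝ := fun j => ∑ i, sgn (z i).2 * (2 * δ j (z i).1)
          have h1 : S j ^ 2 ≤ ∑ j, S j ^ 2 :=
            Finset.single_le_sum (f := fun j => S j ^ 2) (fun j _ => sq_nonneg _)
              (Finset.mem_univ j)
          change |S j| ≤ (∑ j, S j ^ 2) / (2 * t) + t / 2
          have h2 : S j ^ 2 / (2 * t) ≤ (∑ j, S j ^ 2) / (2 * t) :=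
            div_le_div_of_nonneg_right h1 (by positivity)
          have h3 : |S j| ≤ S j ^ 2 / (2 * t) + t / 2 := by
            rw [← sq_abs (S j)]
            have : |S j| ^ 2 / (2 * t) + t / 2 - |S j| = (|S j| - t) ^ 2 / (2 * t) := by
              field_simp; ring
            have h4 : 0 ≤ (|S j| - t) ^ 2 / (2 * t) := by positivity
            linarith
          linarith
    _ ≤ t := by
        rw [integral_add ((integrable_finsetSum _ fun j _ => hint j).div_const _)
          (integrable_const _), integral_div]
        have : (∫ z : Fin N → V × Bool, ∑ j, (∑ i, sgn (z i).2 * (2 * δ j (z i).1)) ^ 2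
          ∂(Measure.pi fun _ => ν.prod coin)) / (2 * t) ≤ t ^ 2 / (2 * t) :=
          div_le_div_of_nonneg_right hsq (by positivity)
        have h2 : t ^ 2 / (2 * t) = t / 2 := by field_simp
        simp
        linarith

/-- One-sided deviations over finitely many weight vectors. The zero vector is added to the family,
which makes the maximum nonnegative, as Markov's inequality requires. -/
lemma measure_exists_net_le {Ω : Type*} [MeasurableSpace Ω] (P : Measure Ω)
    [IsProbabilityMeasure P] (ν : Measure V) [IsProbabilityMeasure ν] [Nonempty ι]
    {N : ℕ} (hN : 0 < N) {X : Fin N → Ω → V} (hX : ∀ i, Measurable (X i))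
    (hlaw : P.map (fun ω i => X i ω) = Measure.pi fun _ => ν)
    {W : Type*} [Finite W] {δ : ι → V → ℝ} (hδ : ∀ j, Measurable (δ j)) {ϱ : ℝ}
    (hϱ : 0 < ϱ) (hδϱ : ∀ j v, |δ j v| ≤ ϱ) {φ : V → ℝ → ℝ}
    (hφ : Measurable (Function.uncurry φ)) (hφ0 : ∀ v, φ v 0 = 0)
    (hφl : ∀ v u u', |φ v u - φ v u'| ≤ |u - u'|) {wt : W → ι → ℝ} (hwt : ∀ a, ∑ j, |wt a j| ≤ 1)
    {x : ℝ} (hx : 0 < x) :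
    P {ω | ∃ a, x < ∑ i, (φ (X i ω) (∑ j, wt a j * δ j (X i ω))
        - ∫ x, φ x (∑ j, wt a j * δ j x) ∂ν)}
      ≤ ENNReal.ofReal (2 * ϱ * √(N * Fintype.card ι) / x) := by
  set wt' : Option W → ι → ℝ := fun a => a.elim 0 wt with hwt'
  have hw1 : ∀ a, ∑ j, |wt' a j| ≤ 1 := by
    rintro (_ | a)
    · simp [hwt']
    · simpa [hwt'] using hwt a
  have key := integral_iSup_empirical_le ν hδ hϱ hδϱ hφ hφ0 hφl hw1 hN
  set G : Option W → (Fin N → V) → ℝ := fun a v => ∑ i, (φ (v i) (∑ j, wt' a j * δ j (v i))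
        - ∫ x, φ x (∑ j, wt' a j * δ j x) ∂ν) with hG
  have hlm : ∀ a, Measurable fun v => ∑ j, wt' a j * δ j v := fun a =>
    Finset.measurable_sum _ fun j _ => (hδ j).const_mul _
  have hlC : ∀ a v, |∑ j, wt' a j * δ j v| ≤ ϱ := fun a v =>
    (abs_linear_le fun j => hδϱ j v).trans (mul_le_of_le_one_left hϱ.le (hw1 a))
  have hhC : ∀ a v, |φ v (∑ j, wt' a j * δ j v)| ≤ ϱ := fun a v => by
    have := hφl v (∑ j, wt' a j * δ j v) 0
    rw [hφ0, sub_zero, sub_zero] at this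
    exact this.trans (hlC a v)
  have hE : ∀ a, |∫ x, φ x (∑ j, wt' a j * δ j x) ∂ν| ≤ ϱ := fun a => by
    simpa using norm_integral_le_of_norm_le_const (μ := ν)
      (f := fun x => φ x (∑ j, wt' a j * δ j x)) (ae_of_all _ fun v => hhC a v)
  have hGm : ∀ a, Measurable (G a) := fun a => Finset.measurable_sum _ fun i _ =>
    ((hφ.comp (measurable_id.prodMk (hlm a))).comp (measurable_pi_apply i)).sub_const _
  have hGi : Integrable (fun v => ⨆ a, G a v) (Measure.pi fun _ : Fin N => ν) :=
    integrable_iSup (C := N * (2 * ϱ)) hGm fun a v => by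
      refine (Finset.abs_sum_le_sum_abs _ _).trans ?_
      refine (Finset.sum_le_sum (g := fun _ => 2 * ϱ) fun i _ => ?_).trans (by simp)
      refine (abs_sub _ _).trans ?_
      linarith [hhC a (v i), hE a]
  have hG0 : ∀ v, 0 ≤ ⨆ a, G a v := fun v => by
    refine le_trans (le_of_eq ?_) (le_iSup_of_finite (fun a => G a v) none)
    simp [hG, hwt', hφ0]
  have hXm : Measurable fun ω i => X i ω := measurable_pi_lambda _ hX
  have hsub : {ω | ∃ a, x < ∑ i, (φ (X i ω) (∑ j, wt a j * δ j (X i ω))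
        - ∫ x, φ x (∑ j, wt a j * δ j x) ∂ν)}
      ⊆ (fun ω i => X i ω) ⁻¹' {v | x ≤ ⨆ a, G a v} := by
    rintro ω ⟨a, ha⟩
    exact ha.le.trans (le_iSup_of_finite (fun a => G a fun i => X i ω) (some a))
  refine (measure_mono hsub).trans ?_
  rw [← Measure.map_apply hXm (measurableSet_le measurable_const (Measurable.iSup hGm)), hlaw]
  have hM := mul_meas_ge_le_integral_of_nonneg (μ := Measure.pi fun _ : Fin N => ν)
    (ae_of_all _ hG0) hGi x
  rw [← ofReal_measureReal]
  refine ENNReal.ofReal_le_ofReal ?_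
  rw [le_div_iff₀ hx, mul_comm]
  exact hM.trans key

/-- Uniform deviations over the whole simplex: the probability of a deviation of more than a
multiple of `ϱ √(N p)`, where `p` is the dimension. -/
lemma measure_exists_simplex_le {Ω : Type*} [MeasurableSpace Ω] (P : Measure Ω)
    [IsProbabilityMeasure P] (ν : Measure V) [IsProbabilityMeasure ν] [Nonempty ι]
    {N : ℕ} (hN : 0 < N) {X : Fin N → Ω → V} (hX : ∀ i, Measurable (X i))
    (hlaw : P.map (fun ω i => X i ω) = Measure.pi fun _ => ν)
    {δ : ι → V → ℝ} (hδ : ∀ j, Measurable (δ j)) {ϱ : ℝ}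
    (hϱ : 0 < ϱ) (hδϱ : ∀ j v, |δ j v| ≤ ϱ) {φ : V → ℝ → ℝ}
    (hφ : Measurable (Function.uncurry φ)) (hφ0 : ∀ v, φ v 0 = 0)
    (hφl : ∀ v u u', |φ v u - φ v u'| ≤ |u - u'|) {x : ℝ} (hx : 0 < x) :
    P {ω | ∃ w ∈ stdSimplex ℝ ι, 2 * x < |∑ i, (φ (X i ω) (∑ j, w j * δ j (X i ω))
        - ∫ x, φ x (∑ j, w j * δ j x) ∂ν)|}
      ≤ ENNReal.ofReal (4 * ϱ * √(N * Fintype.card ι) / x) := by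
  have hp : (0 : ℝ) < Fintype.card ι := by exact_mod_cast Fintype.card_pos
  have hN' : (0 : ℝ) < N := by exact_mod_cast hN
  set G : (ι → ℝ) → Ω → ℝ := fun w ω => ∑ i, (φ (X i ω) (∑ j, w j * δ j (X i ω))
        - ∫ x, φ x (∑ j, w j * δ j x) ∂ν) with hG
  -- the mesh of the net is so small that the deviation changes by at most `x` within a cell
  set e : ℝ := x / (2 * N * Fintype.card ι * ϱ) with he
  have hepos : 0 < e := by positivity
  obtain ⟨t, hts, htf, htc⟩ := (isCompact_stdSimplex ℝ ι).finite_cover_balls hepos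
  have : Finite t := htf
  have hsum : ∀ w ∈ stdSimplex ℝ ι, ∑ j, |w j| = 1 := fun w hw => by
    rw [← hw.2]
    exact Finset.sum_congr rfl fun j _ => abs_of_nonneg (hw.1 j)
  have hint : ∀ w : ι → ℝ, Integrable (fun v => φ v (∑ j, w j * δ j v)) ν := fun w => by
    refine Integrable.of_bound (C := (∑ j, |w j|) * ϱ) ?_ (ae_of_all _ fun v => ?_)
    · exact (hφ.comp (measurable_id.prodMk
        (Finset.measurable_sum _ fun j _ => (hδ j).const_mul _))).aestronglyMeasurable
    · have := hφl v (∑ j, w j * δ j v) 0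
      rw [hφ0, sub_zero, sub_zero] at this
      exact this.trans (abs_linear_le fun j => hδϱ j v)
  have hcell : ∀ w w' : ι → ℝ, dist w w' < e → ∀ ω, |G w ω - G w' ω| ≤ x := by
    intro w w' hww ω
    have hpt : ∀ v, |φ v (∑ j, w j * δ j v) - φ v (∑ j, w' j * δ j v)|
        ≤ Fintype.card ι * e * ϱ := fun v => by
      refine (hφl v _ _).trans ?_
      rw [← Finset.sum_sub_distrib]
      simp only [← sub_mul]
      refine (abs_linear_le fun j => hδϱ j v).trans (mul_le_mul_of_nonneg_right ?_ hϱ.le)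
      refine (Finset.sum_le_sum (g := fun _ => e) fun j _ => ?_).trans (by simp)
      rw [← Real.dist_eq]
      exact (dist_le_pi_dist w w' j).trans hww.le
    have hex : |∫ v, φ v (∑ j, w j * δ j v) ∂ν - ∫ v, φ v (∑ j, w' j * δ j v) ∂ν|
        ≤ Fintype.card ι * e * ϱ := by
      rw [← integral_sub (hint w) (hint w')]
      simpa using norm_integral_le_of_norm_le_const (μ := ν)
        (f := fun v => φ v (∑ j, w j * δ j v) - φ v (∑ j, w' j * δ j v))
        (ae_of_all _ fun v => hpt v)
    simp only [hG]
    rw [← Finset.sum_sub_distrib]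
    refine (Finset.abs_sum_le_sum_abs _ _).trans ?_
    refine (Finset.sum_le_sum (g := fun _ => 2 * (Fintype.card ι * e * ϱ)) fun i _ => ?_).trans
      (le_of_eq ?_)
    · rw [sub_sub_sub_comm]
      refine (abs_sub _ _).trans ?_
      linarith [hpt (X i ω)]
    · rw [Finset.sum_const, Finset.card_univ, Fintype.card_fin, nsmul_eq_mul, he]
      field_simp
  have hpos := measure_exists_net_le P ν hN hX hlaw hδ hϱ hδϱ hφ hφ0 hφl
    (wt := fun a : t => (a : ι → ℝ)) (fun a => (hsum a (hts a.2)).le) hx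
  -- the lower deviations are the upper deviations of the negated loss
  have hneg := measure_exists_net_le P ν hN hX hlaw hδ hϱ hδϱ (φ := fun v u => -φ v u) hφ.neg
    (fun v => by simp [hφ0]) (fun v u u' => by
      rw [← neg_sub_neg, neg_neg, neg_neg]; rw [abs_sub_comm u]; exact hφl v u' u)
    (wt := fun a : t => (a : ι → ℝ)) (fun a => (hsum a (hts a.2)).le) hx
  have hsub : {ω | ∃ w ∈ stdSimplex ℝ ι, 2 * x < |G w ω|} ⊆
      {ω | ∃ a : t, x < G a ω} ∪ {ω | ∃ a : t, x < ∑ i, (-φ (X i ω) (∑ j, a.1 j * δ j (X i ω))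
        - ∫ x, -φ x (∑ j, a.1 j * δ j x) ∂ν)} := by
    rintro ω ⟨w, hw, hwx⟩
    obtain ⟨a, hat, ha⟩ := Set.mem_iUnion₂.1 (htc hw)
    have h1 := hcell w a ha ω
    have h2 : x < |G a ω| := by
      have := abs_sub_abs_le_abs_sub (G w ω) (G a ω)
      linarith
    rcases lt_abs.1 h2 with h3 | h3
    · exact Or.inl ⟨⟨a, hat⟩, h3⟩
    · refine Or.inr ⟨⟨a, hat⟩, h3.trans_le (le_of_eq ?_)⟩
      simp only [hG, integral_neg, ← Finset.sum_neg_distrib]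
      exact Finset.sum_congr rfl fun i _ => by ring
  refine (measure_mono hsub).trans ((measure_union_le _ _).trans ((add_le_add hpos hneg).trans ?_))
  rw [← ENNReal.ofReal_add (by positivity) (by positivity)]
  exact ENNReal.ofReal_le_ofReal (le_of_eq (by ring))

end Deviation

/-! ### The check function -/

section Check

variable {τ : ℝ}

lemma check_zero_right (τ : ℝ) : check τ 0 = 0 := by simp [check]

lemma check_eq_max (τ e : ℝ) : check τ e = max (τ * e) ((τ - 1) * e) := by
  rw [check]
  split_ifs with h
  · rw [max_eq_right]; nlinarith
  · rw [max_eq_left]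
    · ring
    · nlinarith

lemma measurable_check (τ : ℝ) : Measurable (check τ) := by
  have : check τ = fun e => max (τ * e) ((τ - 1) * e) := funext (check_eq_max τ)
  rw [this]
  fun_prop

lemma check_nonneg (h0 : 0 < τ) (h1 : τ < 1) (e : ℝ) : 0 ≤ check τ e := by
  rw [check_eq_max]
  rcases le_total 0 e with h | h
  · exact le_max_of_le_left (by positivity)
  · exact le_max_of_le_right (mul_nonneg_of_nonpos_of_nonpos (by linarith) h)

lemma abs_check_sub_le (h0 : 0 < τ) (h1 : τ < 1) (a b : ℝ) :
    |check τ a - check τ b| ≤ |a - b| := by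
  rw [check_eq_max, check_eq_max]
  refine (abs_max_sub_max_le_max _ _ _ _).trans (max_le ?_ ?_)
  · rw [← mul_sub, abs_mul, abs_of_pos h0]
    exact mul_le_of_le_one_left (abs_nonneg _) h1.le
  · rw [← mul_sub, abs_mul]
    exact mul_le_of_le_one_left (abs_nonneg _) (abs_le.2 ⟨by linarith, by linarith⟩)

lemma check_le_add (h0 : 0 < τ) (h1 : τ < 1) (a b : ℝ) :
    check τ a ≤ check τ b + |a - b| := by
  linarith [le_abs_self (check τ a - check τ b), abs_check_sub_le h0 h1 a b]

lemma check_le_abs (h0 : 0 < τ) (h1 : τ < 1) (a : ℝ) : check τ a ≤ |a| := by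
  simpa [check_zero_right] using check_le_add h0 h1 a 0

/-- The subgradient inequality of the check function. -/
lemma check_sub_ge (τ e u : ℝ) :
    check τ e - u * (τ - if e ≤ 0 then 1 else 0) ≤ check τ (e - u) := by
  rw [check_eq_max τ (e - u), check]
  split_ifs
  · exact le_max_of_le_right (by linarith)
  · exact le_max_of_le_left (by linarith)

/-- Coercivity: a finite expected check loss implies integrability. -/
lemma abs_le_check (τ e : ℝ) :
    min τ (1 - τ) * |e| ≤ check τ e := by
  rw [check_eq_max]
  rcases abs_cases e with ⟨h, h'⟩ | ⟨h, h'⟩ <;> rw [h]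
  · exact le_max_of_le_left (mul_le_mul_of_nonneg_right (min_le_left _ _) h')
  · refine le_max_of_le_right ?_
    have := mul_le_mul_of_nonneg_right (min_le_right τ (1 - τ)) (neg_nonneg.2 h'.le)
    linarith

end Check

/-! ### Perturbation of an integrated product -/

/-- The slope error is weighted by the curve `u`, the curve error by the limit slope `b'`, of which
only `L₁`-bounds are available. No integrability of `b' * u'` is needed: if the right side is finite, it follows. -/
lemma enorm_integral_mul_sub_le {α : Type*} [MeasurableSpace α] {μ : Measure α} {b u b' u' : α → ℝ}
    (hb : AEMeasurable b μ) (hu : AEMeasurable u μ) (hb' : AEMeasurable b' μ)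
    (hu' : AEMeasurable u' μ) (hbu : Integrable (fun t => b t * u t) μ) :
    ‖∫ t, b t * u t ∂μ - ∫ t, b' t * u' t ∂μ‖ₑ
      ≤ ∫⁻ t, ‖b t - b' t‖ₑ * ‖u t‖ₑ ∂μ + ∫⁻ t, ‖b' t‖ₑ * ‖u t - u' t‖ₑ ∂μ := by
  have hle : ∫⁻ t, ‖b t * u t - b' t * u' t‖ₑ ∂μ
      ≤ ∫⁻ t, ‖b t - b' t‖ₑ * ‖u t‖ₑ ∂μ + ∫⁻ t, ‖b' t‖ₑ * ‖u t - u' t‖ₑ ∂μ := by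
    rw [← lintegral_add_left' (f := fun t => ‖b t - b' t‖ₑ * ‖u t‖ₑ)
      ((hb.sub hb').enorm.mul hu.enorm)]
    refine lintegral_mono fun t => ?_
    have : b t * u t - b' t * u' t = (b t - b' t) * u t + b' t * (u t - u' t) := by ring
    rw [this, ← enorm_mul, ← enorm_mul]
    exact enorm_add_le _ _
  by_cases hi : Integrable (fun t => b t * u t - b' t * u' t) μ
  · have hi' : Integrable (fun t => b' t * u' t) μ := by
      have h := hbu.sub hi
      rwa [show ((fun t => b t * u t) - fun t => b t * u t - b' t * u' t)
        = fun t => b' t * u' t from funext fun t => sub_sub_cancel _ _] at h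
    rw [← integral_sub hbu hi']
    exact (enorm_integral_le_lintegral_enorm _).trans hle
  · have : ∫⁻ t, ‖b t * u t - b' t * u' t‖ₑ ∂μ = ∞ := by
      by_contra h
      exact hi ⟨((hb.mul hu).sub (hb'.mul hu')).aestronglyMeasurable, lt_top_iff_ne_top.2 h⟩
    rw [this, top_le_iff] at hle
    rw [hle]
    exact le_top

/-! ### Measurability of the scores and of the model quantities -/

lemma measurable_inv_apply {α n : Type*} [MeasurableSpace α] [Fintype n] [DecidableEq n]
    {A : α → Matrix n n ℝ} (hA : ∀ i j, Measurable fun a => A a i j) (i j : n) :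
    Measurable fun a => (A a)⁻¹ i j := by
  have hdet : ∀ {B : α → Matrix n n ℝ}, (∀ i j, Measurable fun a => B a i j) →
      Measurable fun a => (B a).det := fun {B} hB => by
    simp only [Matrix.det_apply']
    exact Finset.measurable_sum _ fun σ _ => (Finset.measurable_prod _ fun i _ => hB _ _).const_mul _
  simp only [Matrix.inv_def, Ring.inverse_eq_inv', Matrix.smul_apply, smul_eq_mul,
    Matrix.adjugate_apply]
  refine (hdet hA).inv.mul (hdet fun k l => ?_)
  by_cases h : k = j
  · subst h
    simp
  · simp only [Matrix.updateRow_ne h]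
    exact hA k l

/-- Scores are measurable in the curve observations, the number of which may vary. -/
lemma measurable_score {α : Type*} [MeasurableSpace α] {I : Set ℝ} {f : FPCAFit}
    (hf : f.IsFPCA I) {N : α → ℕ} {T U : α → ℕ → ℝ} (hN : Measurable N)
    (hT : ∀ l, Measurable fun a => T a l) (hU : ∀ l, Measurable fun a => U a l) (j : ℕ) :
    Measurable fun a => f.score ⟨N a, fun l => T a l, fun l => U a l⟩ j := by
  have key : Measurable fun z : ℕ × α =>
      f.score ⟨z.1, fun l => T z.2 l, fun l => U z.2 l⟩ j := by
    refine measurable_from_prod_countable_right fun k => ?_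
    change Measurable fun a => f.eigval j * ∑ l : Fin k, f.eigfun j (T a l) * ∑ l' : Fin k,
      (f.obsCov ⟨k, fun l => T a l, fun l => U a l⟩)⁻¹ l l' * (U a l' - f.mean (T a l'))
    refine Measurable.const_mul ?_ _
    refine Finset.measurable_sum _ fun l _ => ?_
    refine ((hf.eigfun_meas j).comp (hT l)).mul ?_
    refine Finset.measurable_sum _ fun l' _ => ?_
    refine Measurable.mul ?_ ((hU l').sub (hf.mean_meas.comp (hT l')))
    refine measurable_inv_apply (n := Fin k)
      (A := fun a => f.obsCov ⟨k, fun l => T a l, fun l => U a l⟩) (fun i i' => ?_) l l'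
    have h : Measurable fun a => f.cov (T a i) (T a i') := hf.cov_meas.comp ((hT i).prodMk (hT i'))
    change Measurable fun a => f.cov (T a i) (T a i') + if i = i' then f.noiseVar else 0
    split_ifs
    · exact h.add_const _
    · exact h.add_const _
  exact key.comp (hN.prodMk measurable_id)

namespace FPCAFit

variable {I : Set ℝ} {f : FPCAFit}

lemma measurable_curve_sub_mean {α : Type*} [MeasurableSpace α]
    (hf : f.IsFPCA I) {o : α → CurveObs} (ho : ∀ j, Measurable fun a => f.score (o a) j) (J : ℕ) :
    Measurable fun z : α × ℝ => f.curve (o z.1) J z.2 - f.mean z.2 := by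
  simp only [curve, add_sub_cancel_left]
  exact Finset.measurable_sum _ fun j _ =>
    ((ho j).comp measurable_fst).mul ((hf.eigfun_meas j).comp measurable_snd)

lemma memLp_curve_sub_mean (hf : f.IsFPCA I) (o : CurveObs) (J : ℕ) :
    MemLp (fun t => f.curve o J t - f.mean t) 2 (volume.restrict I) := by
  simp only [curve, add_sub_cancel_left]
  exact memLp_finsetSum _ fun j _ => (hf.eigfun_memLp j).const_mul _

end FPCAFit

namespace Estimators

variable {𝒥 : ℕ → Finset ℕ} {m : Estimators 𝒥} {I : Set ℝ} {n : ℕ}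

lemma measurable_slope {D : Sample n} {A : Finset (Fin n)} (hf : (m.fpca n D A).IsFPCA I) (J : ℕ) :
    Measurable (m.slope D A J) := by
  unfold slope
  exact Finset.measurable_sum _ fun j _ => (hf.eigfun_meas j).const_mul _

lemma memLp_slope {D : Sample n} {A : Finset (Fin n)} (hf : (m.fpca n D A).IsFPCA I) (J : ℕ) :
    MemLp (m.slope D A J) 2 (volume.restrict I) := by
  unfold slope
  exact memLp_finsetSum _ fun j _ => (hf.eigfun_memLp j).const_mul _

lemma measurable_pred {α : Type*} [MeasurableSpace α] {D : Sample n} {A : Finset (Fin n)}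
    (hA : (m.fpca n D A).IsFPCA I) (hf : (m.fpca n D Finset.univ).IsFPCA I) {o : α → CurveObs}
    (ho : ∀ j, Measurable fun a => (m.fpca n D Finset.univ).score (o a) j) (J : ℕ) :
    Measurable fun a => m.pred I D A J (o a) := by
  unfold pred
  refine Measurable.const_add ?_ _
  have : Measurable fun z : α × ℝ => m.slope D A J z.2 *
      ((m.fpca n D Finset.univ).curve (o z.1) J z.2 - (m.fpca n D Finset.univ).mean z.2) :=
    ((measurable_slope hA J).comp measurable_snd).mul
      (FPCAFit.measurable_curve_sub_mean hf ho J)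
  exact this.stronglyMeasurable.integral_prod_right.measurable

end Estimators

/-! ### The model: measurability, laws, and the optimality of the conditional quantile -/

namespace Model

section ObsFun

variable {Ω S D : Type*} {M : Model Ω S D}

/-- The observations of the curve of unit `i`, as a function of its covariate and its observation
scheme. -/
def obsFun (M : Model Ω S D) (n i : ℕ) (z : S × D) : CurveObs where
  N := M.N n i z.2
  T := fun l => M.T n i z.2 l
  U := fun l => M.ev z.1 (M.T n i z.2 l) + M.noise z.2 l

lemma obs_eq_obsFun (n i : ℕ) (ω : Ω) : M.obs n i ω = M.obsFun n i (M.x i ω, M.d i ω) := rfl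

end ObsFun

variable {Ω S D : Type*} [MeasurableSpace Ω] [MeasurableSpace S] [MeasurableSpace D]
  {P : Measure Ω} {M : Model Ω S D}

/-- The conditional quantile `Q_τ` as a function of the covariate. -/
noncomputable def quantileFun (M : Model Ω S D) (P : Measure Ω) (s : S) : ℝ :=
  M.a + ∫ t in M.I, M.b t * (M.ev s t - M.mu P t)

/-- Response, covariate and observation scheme of unit `i`. -/
def unit (M : Model Ω S D) (i : ℕ) (ω : Ω) : ℝ × S × D := (M.Y i ω, M.x i ω, M.d i ω)

lemma measurable_unit (hM : M.IsFLQR P) (i : ℕ) : Measurable (M.unit i) :=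
  (hM.Y_meas i).prodMk ((hM.x_meas i).prodMk (hM.d_meas i))

lemma map_unit (hM : M.IsFLQR P) (i : ℕ) : P.map (M.unit i) = P.map (M.unit 0) :=
  (hM.ident i).map_eq

lemma measurable_score_obsFun (hM : M.IsFLQR P) {f : FPCAFit} (hf : f.IsFPCA M.I) (n i j : ℕ) :
    Measurable fun z => f.score (M.obsFun n i z) j := by
  refine measurable_score hf (N := fun z : S × D => M.N n i z.2)
    (T := fun z l => M.T n i z.2 l) (U := fun z l => M.ev z.1 (M.T n i z.2 l) + M.noise z.2 l)
    ((hM.N_meas n i).comp measurable_snd) (fun l => (hM.T_meas n i l).comp measurable_snd)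
    (fun l => ?_) j
  have h : Measurable fun z : S × D => M.ev z.1 (M.T n i z.2 l) :=
    hM.ev_meas.comp (measurable_fst.prodMk ((hM.T_meas n i l).comp measurable_snd))
  exact h.add ((hM.noise_meas l).comp measurable_snd)

variable [IsProbabilityMeasure P]

/-- The joint law of finitely many sampled units is a product measure. -/
lemma map_units (hM : M.IsFLQR P) (N : ℕ) :
    P.map (fun ω (i : Fin N) => M.unit (i + 1) ω) = Measure.pi fun _ => P.map (M.unit 0) := by
  have h : iIndepFun (fun (i : Fin N) => M.unit (i + 1)) P :=
    hM.indep.precomp (g := fun i : Fin N => (i : ℕ) + 1) fun i j h => Fin.ext (by simpa using h)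
  rw [(iIndepFun_iff_map_fun_eq_pi_map fun i => (measurable_unit hM _).aemeasurable).1 h]
  simp only [map_unit hM]

lemma measurable_mu (hM : M.IsFLQR P) : Measurable (M.mu P) := by
  have : Measurable fun z : ℝ × Ω => M.ev (M.x 0 z.2) z.1 :=
    hM.ev_meas.comp (((hM.x_meas 0).comp measurable_snd).prodMk measurable_fst)
  exact this.stronglyMeasurable.integral_prod_right.measurable

lemma measurable_quantileFun (hM : M.IsFLQR P) : Measurable (M.quantileFun P) := by
  have : Measurable fun z : S × ℝ => M.b z.2 * (M.ev z.1 z.2 - M.mu P z.2) :=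
    (hM.b_meas.comp measurable_snd).mul
      (hM.ev_meas.sub ((measurable_mu hM).comp measurable_snd))
  exact this.stronglyMeasurable.integral_prod_right.measurable.const_add _

lemma measurable_eps (hM : M.IsFLQR P) (i : ℕ) : Measurable (M.eps P i) :=
  (hM.Y_meas i).sub ((measurable_quantileFun hM).comp (hM.x_meas i))

lemma integrable_check_eps (hM : M.IsFLQR P) :
    Integrable (fun ω => check M.τ (M.eps P 0 ω)) P := by
  refine hM.eps_int.mono ((measurable_check _).comp (measurable_eps hM 0)).aestronglyMeasurable
    (ae_of_all _ fun ω => ?_)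
  rw [Real.norm_of_nonneg (check_nonneg hM.tau_pos hM.tau_lt_one _)]
  exact check_le_abs hM.tau_pos hM.tau_lt_one _

/-- `E ρ_τ(ε) > 0`: otherwise `ε = 0` and `P(ε ≤ 0) = 1 ≠ τ`. -/
lemma integral_check_eps_pos (hM : M.IsFLQR P) : 0 < ∫ ω, check M.τ (M.eps P 0 ω) ∂P := by
  refine lt_of_le_of_ne (integral_nonneg fun ω => check_nonneg hM.tau_pos hM.tau_lt_one _)
    fun h => ?_
  have h0 := (integral_eq_zero_iff_of_nonneg
    (fun ω => check_nonneg hM.tau_pos hM.tau_lt_one (M.eps P 0 ω))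
    (integrable_check_eps hM)).1 h.symm
  have hc : ∀ᵐ ω ∂P, Set.indicator {ω | M.eps P 0 ω ≤ 0} (fun _ => (1 : ℝ)) ω = 1 := by
    filter_upwards [h0] with ω hω
    have h1 := abs_le_check M.τ (M.eps P 0 ω)
    rw [hω] at h1
    have h2 : 0 < min M.τ (1 - M.τ) := lt_min hM.tau_pos (by linarith [hM.tau_lt_one])
    have h3 : |M.eps P 0 ω| ≤ 0 := by
      by_contra h4
      push Not at h4
      exact absurd h1 (not_le.2 (mul_pos h2 h4))
    simp [abs_nonpos_iff.1 h3]
  have hm : MeasurableSpace.comap (M.x 0) inferInstance ≤ (inferInstance : MeasurableSpace Ω) :=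
    (hM.x_meas 0).comap_le
  have e1 := integral_condExp (μ := P) (f := Set.indicator {ω | M.eps P 0 ω ≤ 0}
    (fun _ => (1 : ℝ))) hm
  rw [integral_congr_ae hM.quantile, integral_congr_ae hc] at e1
  simp at e1
  exact hM.tau_lt_one.ne e1

/-- No function of the covariate and the observation scheme predicts better than `Q_τ`. -/
lemma integral_check_eps_le (hM : M.IsFLQR P) {f : S × D → ℝ} (hf : Measurable f) :
    ENNReal.ofReal (∫ ω, check M.τ (M.eps P 0 ω) ∂P)
      ≤ ∫⁻ ω, ENNReal.ofReal (check M.τ (M.Y 0 ω - f (M.x 0 ω, M.d 0 ω))) ∂P := by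
  by_cases hfin : ∫⁻ ω, ENNReal.ofReal (check M.τ (M.Y 0 ω - f (M.x 0 ω, M.d 0 ω))) ∂P = ∞
  · rw [hfin]; exact le_top
  have hτ : 0 < min M.τ (1 - M.τ) := lt_min hM.tau_pos (by linarith [hM.tau_lt_one])
  have hxd : Measurable fun ω => (M.x 0 ω, M.d 0 ω) := (hM.x_meas 0).prodMk (hM.d_meas 0)
  have hYf : Measurable fun ω => M.Y 0 ω - f (M.x 0 ω, M.d 0 ω) := (hM.Y_meas 0).sub (hf.comp hxd)
  have hnn : ∀ ω, 0 ≤ check M.τ (M.Y 0 ω - f (M.x 0 ω, M.d 0 ω)) := fun ω =>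
    check_nonneg hM.tau_pos hM.tau_lt_one _
  have hci : Integrable (fun ω => check M.τ (M.Y 0 ω - f (M.x 0 ω, M.d 0 ω))) P := by
    refine ⟨((measurable_check _).comp hYf).aestronglyMeasurable, ?_⟩
    rw [hasFiniteIntegral_iff_ofReal (ae_of_all _ hnn)]
    exact lt_top_iff_ne_top.2 hfin
  have hYfi : Integrable (fun ω => M.Y 0 ω - f (M.x 0 ω, M.d 0 ω)) P := by
    refine (hci.const_mul (min M.τ (1 - M.τ))⁻¹).mono hYf.aestronglyMeasurable
      (ae_of_all _ fun ω => ?_)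
    rw [Real.norm_of_nonneg (mul_nonneg (inv_pos.2 hτ).le (hnn ω)), Real.norm_eq_abs,
      le_inv_mul_iff₀ hτ]
    exact abs_le_check _ _
  set u : Ω → ℝ := fun ω => f (M.x 0 ω, M.d 0 ω) - M.quantileFun P (M.x 0 ω) with hu
  have hue : ∀ ω, M.Y 0 ω - f (M.x 0 ω, M.d 0 ω) = M.eps P 0 ω - u ω := fun ω => by
    simp only [hu, eps]
    change _ = M.Y 0 ω - M.quantileFun P (M.x 0 ω) - _
    ring
  have hui : Integrable u P := by
    refine (hM.eps_int.sub hYfi).congr (ae_of_all _ fun ω => ?_)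
    simp only [Pi.sub_apply, hue ω, sub_sub_cancel]
  set one : Ω → ℝ := Set.indicator {ω | M.eps P 0 ω ≤ 0} (fun _ => (1 : ℝ)) with hone
  have hset : MeasurableSet {ω | M.eps P 0 ω ≤ 0} :=
    measurableSet_le (measurable_eps hM 0) measurable_const
  have honei : Integrable one P := (integrable_const 1).indicator hset
  have huo : Integrable (u * one) P := by
    refine hui.mono (hui.aestronglyMeasurable.mul honei.aestronglyMeasurable)
      (ae_of_all _ fun ω => ?_)
    rw [Pi.mul_apply, norm_mul]
    refine mul_le_of_le_one_right (norm_nonneg _) ?_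
    by_cases h : M.eps P 0 ω ≤ 0 <;> simp [hone, h]
  have hm : MeasurableSpace.comap (fun ω => (M.x 0 ω, M.d 0 ω)) inferInstance
      ≤ (inferInstance : MeasurableSpace Ω) := hxd.comap_le
  have hum : StronglyMeasurable[MeasurableSpace.comap (fun ω => (M.x 0 ω, M.d 0 ω)) inferInstance]
      u := by
    have hg : Measurable fun z : S × D => f z - M.quantileFun P z.1 :=
      hf.sub ((measurable_quantileFun hM).comp measurable_fst)
    exact (hg.comp (comap_measurable _)).stronglyMeasurable
  have hce := condExp_mul_of_stronglyMeasurable_left hum huo honei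
  have hzero : ∫ ω, u ω * one ω ∂P = ∫ ω, u ω * M.τ ∂P := by
    rw [← integral_condExp hm (f := fun ω => u ω * one ω)]
    refine integral_congr_ae ?_
    filter_upwards [hce, hM.cond_indep 0, hM.quantile] with ω h1 h2 h3
    change (P[u * one|_]) ω = _
    rw [h1, Pi.mul_apply, h2, h3]
  have hsub : ∀ ω, check M.τ (M.eps P 0 ω) - (u ω * M.τ - u ω * one ω)
      ≤ check M.τ (M.Y 0 ω - f (M.x 0 ω, M.d 0 ω)) := fun ω => by
    rw [hue ω]
    refine le_trans (le_of_eq ?_) (check_sub_ge M.τ (M.eps P 0 ω) (u ω))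
    simp only [hone, Set.indicator_apply, Set.mem_ofPred_eq]
    ring
  rw [← ofReal_integral_eq_lintegral_ofReal hci (ae_of_all _ hnn)]
  refine ENNReal.ofReal_le_ofReal ?_
  have hint : Integrable (fun ω => u ω * M.τ - u ω * one ω) P := (hui.mul_const _).sub huo
  have := integral_mono ((integrable_check_eps hM).sub hint) hci hsub
  rw [integral_sub' (integrable_check_eps hM) hint,
    integral_sub (g := fun ω => u ω * one ω) (hui.mul_const _) huo, hzero, sub_self,
    sub_zero] at this
  exact this

end Model

/-! ### The limits of the estimators -/

namespace Limits

variable {Ω S D : Type*} [MeasurableSpace Ω] {P : Measure Ω} {M : Model Ω S D}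
  {𝒥 : ℕ → Finset ℕ} {L : Limits S D}

/-- The limit prediction `Q*_{τ,J}` as a function of the covariate and the observation scheme. -/
noncomputable def predFun (L : Limits S D) (M : Model Ω S D) (P : Measure Ω) (n J : ℕ)
    (z : S × D) : ℝ :=
  L.a n J + ∫ t in M.I, L.b n J t * (L.X n J z t - M.mu P t)

/-- The excess `Q*_{τ,J} - Q_τ` of unit values `(y, x, d)`, truncated at `±ϱ`, so that the
almost sure bound `ϱ` holds everywhere. -/
noncomputable def excess (L : Limits S D) (M : Model Ω S D) (P : Measure Ω) (ϱ : ℝ) (n J : ℕ)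
    (v : ℝ × S × D) : ℝ :=
  max (-ϱ) (min ϱ (L.predFun M P n J v.2 - M.quantileFun P v.2.1))

lemma abs_excess_le {ϱ : ℝ} (hϱ : 0 < ϱ) (n J : ℕ) (v : ℝ × S × D) :
    |L.excess M P ϱ n J v| ≤ ϱ :=
  abs_le.2 ⟨le_max_left _ _, max_le (by linarith) (min_le_left _ _)⟩

lemma excess_eq {ϱ : ℝ} {n J : ℕ} {i : ℕ} {ω : Ω} (h : |L.Q M P n J i ω - M.Q P i ω| ≤ ϱ) :
    L.excess M P ϱ n J (M.unit i ω) = L.Q M P n J i ω - M.Q P i ω := by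
  change max (-ϱ) (min ϱ (L.Q M P n J i ω - M.Q P i ω)) = _
  rw [min_eq_right (abs_le.1 h).2, max_eq_right (abs_le.1 h).1]

variable [MeasurableSpace S] [MeasurableSpace D] [IsProbabilityMeasure P]

lemma measurable_predFun (hM : M.IsFLQR P) (hL : L.Regular M P 𝒥) (n J : ℕ) :
    Measurable (L.predFun M P n J) := by
  have : Measurable fun z : (S × D) × ℝ => L.b n J z.2 * (L.X n J z.1 z.2 - M.mu P z.2) :=
    ((hL.b_meas n J).comp measurable_snd).mul
      ((hL.X_meas n J).sub ((Model.measurable_mu hM).comp measurable_snd))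
  exact this.stronglyMeasurable.integral_prod_right.measurable.const_add _

/-- The `L₁`-envelope over the candidate set of the limit curves, as a function of the covariate
and the observation scheme. -/
noncomputable def envelope (L : Limits S D) (M : Model Ω S D) (P : Measure Ω)
    (𝒥 : ℕ → Finset ℕ) (n : ℕ) (z : S × D) : ℝ≥0∞ :=
  ⨆ J ∈ 𝒥 n, ∫⁻ t in M.I, ‖L.X n J z t - M.mu P t‖ₑ

lemma measurable_envelope (hM : M.IsFLQR P) (hL : L.Regular M P 𝒥) (n : ℕ) :
    Measurable (L.envelope M P 𝒥 n) := by
  unfold envelope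
  refine Measurable.iSup fun J => Measurable.iSup fun _ => ?_
  have : Measurable fun z : (S × D) × ℝ => ‖L.X n J z.1 z.2 - M.mu P z.2‖ₑ :=
    ((hL.X_meas n J).sub ((Model.measurable_mu hM).comp measurable_snd)).enorm
  exact this.lintegral_prod_right'

lemma lintegral_envelope (hM : M.IsFLQR P) (hL : L.Regular M P 𝒥) (n i : ℕ) :
    ∫⁻ ω, L.envelope M P 𝒥 n (M.x i ω, M.d i ω) ∂P
      = ∫⁻ ω, L.envelope M P 𝒥 n (M.x 0 ω, M.d 0 ω) ∂P := by
  have hm : Measurable fun v : ℝ × S × D => L.envelope M P 𝒥 n v.2 :=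
    (measurable_envelope hM hL n).comp measurable_snd
  have h : ∀ i, ∫⁻ ω, L.envelope M P 𝒥 n (M.x i ω, M.d i ω) ∂P
      = ∫⁻ v, L.envelope M P 𝒥 n v.2 ∂(P.map (M.unit i)) := fun i =>
    (lintegral_map hm (Model.measurable_unit hM i)).symm
  rw [h, h, Model.map_unit hM]

lemma measurable_excess (hM : M.IsFLQR P) (hL : L.Regular M P 𝒥) (ϱ : ℝ) (n J : ℕ) :
    Measurable (L.excess M P ϱ n J) :=
  measurable_const.max (measurable_const.min
    (((measurable_predFun hM hL n J).comp measurable_snd).sub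
      ((Model.measurable_quantileFun hM).comp (measurable_fst.comp measurable_snd))))

end Limits

/-! ### Predictions close to their limits -/

section Close

lemma measurableSet_I {Ω S D : Type*} (M : Model Ω S D) : MeasurableSet M.I := measurableSet_Icc

variable {Ω S D : Type*} [MeasurableSpace Ω] {P : Measure Ω} {M : Model Ω S D}
  {𝒥 : ℕ → Finset ℕ} {L : Limits S D} {m : Estimators 𝒥} {n : ℕ} {ω : Ω} {η : ℝ}

/-- At the sample point `ω`, the estimators are within `η` of their limits, in the sense of the
five bounds of `Condition1`. -/
structure CloseToLimits (M : Model Ω S D) (P : Measure Ω) (m : Estimators 𝒥) (L : Limits S D)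
    (n : ℕ) (ω : Ω) (η : ℝ) : Prop where
  icept : ∀ J ∈ 𝒥 n,
    ‖m.icept n (M.sample n ω) Finset.univ J - L.a n J‖ₑ ≤ ENNReal.ofReal η
  slope : ∀ J ∈ 𝒥 n, ∀ t ∈ M.I,
    ‖m.slope (M.sample n ω) Finset.univ J t - L.b n J t‖ₑ ≤ ENNReal.ofReal η
  mean : ∀ t ∈ M.I,
    ‖(m.fpca n (M.sample n ω) Finset.univ).mean t - M.mu P t‖ₑ ≤ ENNReal.ofReal η
  curve : ∀ J ∈ 𝒥 n, ∀ t ∈ M.I, ∀ i : Fin n,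
    ‖(m.fpca n (M.sample n ω) Finset.univ).curve (M.obs n (i + 1) ω) J t
      - L.curve M n J (i + 1) ω t‖ₑ ≤ ENNReal.ofReal η
  curve_new : ∀ J ∈ 𝒥 n, ∀ t ∈ M.I,
    ∫⁻ ω', ‖(m.fpca n (M.sample n ω) Finset.univ).curve (M.obs n 0 ω') J t
      - L.curve M n J 0 ω' t‖ₑ ∂P ≤ ENNReal.ofReal η

variable [MeasurableSpace S] [MeasurableSpace D] [IsProbabilityMeasure P]

/-- The prediction error relative to the limit, for a curve observed through `o` and a unit with
covariate and observation scheme `z`, in terms of the error of the reconstructed curve. -/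
lemma enorm_pred_sub_predFun_le (hM : M.IsFLQR P) (hL : L.Regular M P 𝒥)
    {τ : ℝ} {K : ℕ → ℕ} (hm : m.IsMethod M.I τ K) (hc : CloseToLimits M P m L n ω η)
    {B : ℝ} {J : ℕ} (hJ : J ∈ 𝒥 n) (hB : ∫⁻ t in M.I, ‖L.b n J t‖ₑ ≤ ENNReal.ofReal B)
    (o : CurveObs) (z : S × D) :
    ‖m.pred M.I (M.sample n ω) Finset.univ J o - L.predFun M P n J z‖ₑ
      ≤ ENNReal.ofReal η * (1 + L.envelope M P 𝒥 n z
          + (∫⁻ t in M.I, ‖(m.fpca n (M.sample n ω) Finset.univ).curve o J t - L.X n J z t‖ₑ)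
          + ENNReal.ofReal η * volume M.I + ENNReal.ofReal B)
        + ∫⁻ t in M.I, ‖L.b n J t‖ₑ *
            ‖(m.fpca n (M.sample n ω) Finset.univ).curve o J t - L.X n J z t‖ₑ := by
  set f := m.fpca n (M.sample n ω) Finset.univ with hf
  have hfp : f.IsFPCA M.I := hm.fpca _ _ _
  have hmu := Model.measurable_mu hM
  have hu : Measurable fun t => f.curve o J t - f.mean t := by
    have h := FPCAFit.measurable_curve_sub_mean (α := Unit) hfp (o := fun _ => o)
      (fun j => measurable_const) J
    exact h.comp (measurable_const.prodMk measurable_id : Measurable fun t : ℝ => ((), t))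
  have hcurve : Measurable fun t => f.curve o J t := by
    convert hu.add hfp.mean_meas using 1
    ext t
    simp
  have hX : Measurable fun t => L.X n J z t :=
    (hL.X_meas n J).comp (measurable_const.prodMk measurable_id)
  have hD : Measurable fun t => ‖f.curve o J t - L.X n J z t‖ₑ := (hcurve.sub hX).enorm
  have hu' : Measurable fun t => L.X n J z t - M.mu P t := hX.sub hmu
  have hsl : Measurable (m.slope (M.sample n ω) Finset.univ J) :=
    Estimators.measurable_slope hfp J
  have hint : Integrable (fun t => m.slope (M.sample n ω) Finset.univ J t *
      (f.curve o J t - f.mean t)) (volume.restrict M.I) :=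
    (Estimators.memLp_slope hfp J).integrable_mul (FPCAFit.memLp_curve_sub_mean hfp o J)
  have hmain := enorm_integral_mul_sub_le (μ := volume.restrict M.I)
    (b := m.slope (M.sample n ω) Finset.univ J) (u := fun t => f.curve o J t - f.mean t)
    (b' := L.b n J) (u' := fun t => L.X n J z t - M.mu P t) hsl.aemeasurable hu.aemeasurable
    (hL.b_meas n J).aemeasurable hu'.aemeasurable hint
  have hdiff : ∀ t ∈ M.I, ‖(f.curve o J t - f.mean t) - (L.X n J z t - M.mu P t)‖ₑ
      ≤ ‖f.curve o J t - L.X n J z t‖ₑ + ENNReal.ofReal η := fun t ht => by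
    rw [sub_sub_sub_comm]
    exact enorm_sub_le.trans (add_le_add_right (hc.mean t ht) _)
  have h1 : ∫⁻ t in M.I, ‖m.slope (M.sample n ω) Finset.univ J t - L.b n J t‖ₑ *
      ‖f.curve o J t - f.mean t‖ₑ ≤ ENNReal.ofReal η * (L.envelope M P 𝒥 n z
        + (∫⁻ t in M.I, ‖f.curve o J t - L.X n J z t‖ₑ) + ENNReal.ofReal η * volume M.I) := by
    calc _ ≤ ∫⁻ t in M.I, ENNReal.ofReal η * (‖L.X n J z t - M.mu P t‖ₑ +
          (‖f.curve o J t - L.X n J z t‖ₑ + ENNReal.ofReal η)) := by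
          refine setLIntegral_mono' (measurableSet_I M) fun t ht => ?_
          refine mul_le_mul' (hc.slope J hJ t ht) ?_
          refine le_trans ?_ (add_le_add_right (hdiff t ht) _)
          refine le_trans (le_of_eq ?_) (enorm_add_le _ _)
          congr 1
          ring
      _ = ENNReal.ofReal η * ((∫⁻ t in M.I, ‖L.X n J z t - M.mu P t‖ₑ)
          + ((∫⁻ t in M.I, ‖f.curve o J t - L.X n J z t‖ₑ) + ENNReal.ofReal η * volume M.I)) := by
          rw [lintegral_const_mul _ (by fun_prop), lintegral_add_left hu'.enorm,
            lintegral_add_left hD, setLIntegral_const]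
      _ ≤ _ := by
          rw [← add_assoc]
          gcongr
          exact le_iSup₂ (f := fun J (_ : J ∈ 𝒥 n) =>
            ∫⁻ t in M.I, ‖L.X n J z t - M.mu P t‖ₑ) J hJ
  have h2 : ∫⁻ t in M.I, ‖L.b n J t‖ₑ *
      ‖(f.curve o J t - f.mean t) - (L.X n J z t - M.mu P t)‖ₑ
      ≤ (∫⁻ t in M.I, ‖L.b n J t‖ₑ * ‖f.curve o J t - L.X n J z t‖ₑ)
        + ENNReal.ofReal η * ENNReal.ofReal B := by
    calc _ ≤ ∫⁻ t in M.I, (‖L.b n J t‖ₑ * ‖f.curve o J t - L.X n J z t‖ₑ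
          + ENNReal.ofReal η * ‖L.b n J t‖ₑ) := by
          refine setLIntegral_mono' (measurableSet_I M) fun t ht => ?_
          refine (mul_le_mul_right (hdiff t ht) _).trans (le_of_eq ?_)
          ring
      _ = (∫⁻ t in M.I, ‖L.b n J t‖ₑ * ‖f.curve o J t - L.X n J z t‖ₑ)
          + ENNReal.ofReal η * ∫⁻ t in M.I, ‖L.b n J t‖ₑ := by
          rw [lintegral_add_right _ ((hL.b_meas n J).enorm.const_mul _),
            lintegral_const_mul _ (hL.b_meas n J).enorm]
      _ ≤ _ := by gcongr
  have h0 : m.pred M.I (M.sample n ω) Finset.univ J o - L.predFun M P n J z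
      = (m.icept n (M.sample n ω) Finset.univ J - L.a n J)
        + ((∫ t in M.I, m.slope (M.sample n ω) Finset.univ J t * (f.curve o J t - f.mean t))
          - ∫ t in M.I, L.b n J t * (L.X n J z t - M.mu P t)) := by
    simp only [Estimators.pred, Limits.predFun, ← hf]
    exact add_sub_add_comm _ _ _ _
  rw [h0]
  refine (enorm_add_le _ _).trans ((add_le_add (hc.icept J hJ)
    (hmain.trans (add_le_add h1 h2))).trans (le_of_eq ?_))
  ring

/-- Predictions of sampled units. -/
lemma enorm_pred_sub_predFun_sample_le (hM : M.IsFLQR P) (hL : L.Regular M P 𝒥)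
    {τ : ℝ} {K : ℕ → ℕ} (hm : m.IsMethod M.I τ K) (hc : CloseToLimits M P m L n ω η)
    {B : ℝ} {J : ℕ} (hJ : J ∈ 𝒥 n) (hB : ∫⁻ t in M.I, ‖L.b n J t‖ₑ ≤ ENNReal.ofReal B)
    (i : Fin n) :
    ‖m.pred M.I (M.sample n ω) Finset.univ J (M.obs n (i + 1) ω)
        - L.predFun M P n J (M.x (i + 1) ω, M.d (i + 1) ω)‖ₑ
      ≤ ENNReal.ofReal η * (1 + L.envelope M P 𝒥 n (M.x (i + 1) ω, M.d (i + 1) ω)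
          + 2 * (ENNReal.ofReal η * volume M.I) + 2 * ENNReal.ofReal B) := by
  refine (enorm_pred_sub_predFun_le hM hL hm hc hJ hB _ _).trans ?_
  have h1 : ∫⁻ t in M.I, ‖(m.fpca n (M.sample n ω) Finset.univ).curve (M.obs n (i + 1) ω) J t
      - L.X n J (M.x (i + 1) ω, M.d (i + 1) ω) t‖ₑ ≤ ENNReal.ofReal η * volume M.I := by
    rw [← setLIntegral_const]
    exact setLIntegral_mono' (measurableSet_I M) fun t ht => hc.curve J hJ t ht i
  have h2 : ∫⁻ t in M.I, ‖L.b n J t‖ₑ *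
      ‖(m.fpca n (M.sample n ω) Finset.univ).curve (M.obs n (i + 1) ω) J t
        - L.X n J (M.x (i + 1) ω, M.d (i + 1) ω) t‖ₑ
      ≤ ENNReal.ofReal B * ENNReal.ofReal η := by
    refine le_trans ?_ (mul_le_mul_left hB _)
    rw [← lintegral_mul_const _ (hL.b_meas n J).enorm]
    exact setLIntegral_mono' (measurableSet_I M) fun t ht =>
      mul_le_mul_right (hc.curve J hJ t ht i) _
  refine (add_le_add (mul_le_mul_right (add_le_add_left (add_le_add_left
    (add_le_add_right h1 _) _) _) (ENNReal.ofReal η)) h2).trans (le_of_eq ?_)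
  ring

/-- Expected predictions of the new unit. -/
lemma lintegral_enorm_pred_sub_predFun_le (hM : M.IsFLQR P) (hL : L.Regular M P 𝒥)
    {τ : ℝ} {K : ℕ → ℕ} (hm : m.IsMethod M.I τ K) (hc : CloseToLimits M P m L n ω η)
    {B B' : ℝ} {J : ℕ} (hJ : J ∈ 𝒥 n) (hB : ∫⁻ t in M.I, ‖L.b n J t‖ₑ ≤ ENNReal.ofReal B)
    (hB' : ∫⁻ ω, L.envelope M P 𝒥 n (M.x 0 ω, M.d 0 ω) ∂P ≤ ENNReal.ofReal B') :
    ∫⁻ ω', ‖m.pred M.I (M.sample n ω) Finset.univ J (M.obs n 0 ω')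
        - L.predFun M P n J (M.x 0 ω', M.d 0 ω')‖ₑ ∂P
      ≤ ENNReal.ofReal η * (1 + ENNReal.ofReal B'
          + 2 * (ENNReal.ofReal η * volume M.I) + 2 * ENNReal.ofReal B) := by
  set f := m.fpca n (M.sample n ω) Finset.univ with hf
  have hfp : f.IsFPCA M.I := hm.fpca _ _ _
  have hxd : Measurable fun ω => (M.x 0 ω, M.d 0 ω) := (hM.x_meas 0).prodMk (hM.d_meas 0)
  have hscore : ∀ j, Measurable fun ω' => f.score (M.obs n 0 ω') j := fun j =>
    (Model.measurable_score_obsFun hM hfp n 0 j).comp hxd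
  have hcurve : Measurable fun z : Ω × ℝ => f.curve (M.obs n 0 z.1) J z.2 := by
    convert (FPCAFit.measurable_curve_sub_mean hfp hscore J).add
      (hfp.mean_meas.comp measurable_snd) using 1
    ext z
    simp
  have hX : Measurable fun z : Ω × ℝ => L.X n J (M.x 0 z.1, M.d 0 z.1) z.2 :=
    (hL.X_meas n J).comp ((hxd.comp measurable_fst).prodMk measurable_snd)
  have hD : Measurable fun z : Ω × ℝ =>
      ‖f.curve (M.obs n 0 z.1) J z.2 - L.X n J (M.x 0 z.1, M.d 0 z.1) z.2‖ₑ :=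
    (hcurve.sub hX).enorm
  have hbD : Measurable fun z : Ω × ℝ => ‖L.b n J z.2‖ₑ *
      ‖f.curve (M.obs n 0 z.1) J z.2 - L.X n J (M.x 0 z.1, M.d 0 z.1) z.2‖ₑ :=
    ((hL.b_meas n J).comp measurable_snd).enorm.mul hD
  have henv : Measurable fun ω => L.envelope M P 𝒥 n (M.x 0 ω, M.d 0 ω) :=
    (Limits.measurable_envelope hM hL n).comp hxd
  have hDi := hD.lintegral_prod_right' (ν := volume.restrict M.I)
  have hbDi := hbD.lintegral_prod_right' (ν := volume.restrict M.I)
  have h1 : ∫⁻ ω', (∫⁻ t in M.I, ‖f.curve (M.obs n 0 ω') J t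
      - L.X n J (M.x 0 ω', M.d 0 ω') t‖ₑ) ∂P ≤ ENNReal.ofReal η * volume M.I := by
    rw [lintegral_lintegral_swap hD.aemeasurable, ← setLIntegral_const]
    exact setLIntegral_mono' (measurableSet_I M) fun t ht => hc.curve_new J hJ t ht
  have h2 : ∫⁻ ω', (∫⁻ t in M.I, ‖L.b n J t‖ₑ * ‖f.curve (M.obs n 0 ω') J t
      - L.X n J (M.x 0 ω', M.d 0 ω') t‖ₑ) ∂P ≤ ENNReal.ofReal B * ENNReal.ofReal η := by
    rw [lintegral_lintegral_swap hbD.aemeasurable]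
    refine le_trans ?_ (mul_le_mul_left hB _)
    rw [← lintegral_mul_const _ (hL.b_meas n J).enorm]
    refine setLIntegral_mono' (measurableSet_I M) fun t ht => ?_
    rw [lintegral_const_mul' _ _ enorm_ne_top]
    exact mul_le_mul_right (hc.curve_new J hJ t ht) _
  refine (lintegral_mono fun ω' => enorm_pred_sub_predFun_le hM hL hm hc hJ hB _ _).trans ?_
  rw [lintegral_add_right _ hbDi, lintegral_const_mul _ (by fun_prop),
    lintegral_add_right _ measurable_const, lintegral_add_right _ measurable_const,
    lintegral_add_right _ hDi, lintegral_add_right _ henv]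
  simp only [lintegral_const, measure_univ, mul_one]
  refine (add_le_add (mul_le_mul_right (add_le_add_left (add_le_add_left
    (add_le_add (add_le_add_right hB' _) h1) _) _) _) h2).trans (le_of_eq ?_)
  ring

end Close

/-! ### Prediction error and cross-validation criterion against the limit risk -/

section Risk

lemma enorm_sum_mul_sub_le {ι : Type*} [Fintype ι] {w : ι → ℝ} (hw : w ∈ stdSimplex ℝ ι)
    (f g : ι → ℝ) :
    ‖∑ j, w j * f j - ∑ j, w j * g j‖ₑ ≤ ∑ j, ENNReal.ofReal (w j) * ‖f j - g j‖ₑ := by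
  rw [← Finset.sum_sub_distrib]
  refine (enorm_sum_le _ _).trans (Finset.sum_le_sum fun j _ => le_of_eq ?_)
  rw [← mul_sub, enorm_mul, Real.enorm_eq_ofReal (hw.1 j)]

lemma sum_ofReal_mul_le {ι : Type*} [Fintype ι] {w : ι → ℝ} (hw : w ∈ stdSimplex ℝ ι)
    {f : ι → ℝ≥0∞} {E : ℝ≥0∞} (hf : ∀ j, f j ≤ E) : ∑ j, ENNReal.ofReal (w j) * f j ≤ E := by
  refine (Finset.sum_le_sum fun j _ => mul_le_mul_right (hf j) _).trans (le_of_eq ?_)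
  rw [← Finset.sum_mul, ← ENNReal.ofReal_sum_of_nonneg fun j _ => hw.1 j, hw.2]
  simp

variable {Ω S D : Type*} [MeasurableSpace Ω] {P : Measure Ω} {M : Model Ω S D}
  {𝒥 : ℕ → Finset ℕ} {L : Limits S D} {m : Estimators 𝒥} {n : ℕ} {ω : Ω} {η : ℝ}

/-- The excess loss `ρ_τ(ε - u) - ρ_τ(ε)` of unit values `v = (y, x, d)`, `ε = y - Q_τ(x)`. -/
noncomputable def excessLoss (M : Model Ω S D) (P : Measure Ω) (v : ℝ × S × D) (u : ℝ) : ℝ :=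
  check M.τ (v.1 - M.quantileFun P v.2.1 - u) - check M.τ (v.1 - M.quantileFun P v.2.1)

/-- The excess risk of the limit prediction with weights `w`. -/
noncomputable def excessRisk [MeasurableSpace S] [MeasurableSpace D] (M : Model Ω S D)
    (P : Measure Ω) (L : Limits S D) (𝒥 : ℕ → Finset ℕ) (ϱ : ℝ) (n : ℕ) (w : 𝒥 n → ℝ) : ℝ :=
  ∫ v, excessLoss M P v (∑ J, w J * L.excess M P ϱ n J v) ∂(P.map (M.unit 0))

lemma sub_sum_predFun_eq {ϱ : ℝ} {i : ℕ} {w : 𝒥 n → ℝ} (hw : w ∈ stdSimplex ℝ (𝒥 n))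
    (h : ∀ J ∈ 𝒥 n, |L.Q M P n J i ω - M.Q P i ω| ≤ ϱ) :
    M.Y i ω - ∑ J : 𝒥 n, w J * L.predFun M P n J (M.x i ω, M.d i ω)
      = M.eps P i ω - ∑ J : 𝒥 n, w J * L.excess M P ϱ n J (M.unit i ω) := by
  have h1 : ∑ J : 𝒥 n, w J * L.excess M P ϱ n J (M.unit i ω)
      = ∑ J : 𝒥 n, w J * L.predFun M P n J (M.x i ω, M.d i ω) - M.Q P i ω := by
    have : M.Q P i ω = ∑ J : 𝒥 n, w J * M.Q P i ω := by rw [← Finset.sum_mul, hw.2, one_mul]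
    rw [this, ← Finset.sum_sub_distrib]
    refine Finset.sum_congr rfl fun J _ => ?_
    rw [Limits.excess_eq (h J J.2), mul_sub]
    rfl
  rw [h1, Model.eps]
  ring

lemma excessLoss_zero (v : ℝ × S × D) : excessLoss M P v 0 = 0 := by simp [excessLoss]

lemma check_eps_add_excessLoss (i : ℕ) (ω : Ω) (u : ℝ) :
    check M.τ (M.eps P i ω) + excessLoss M P (M.unit i ω) u = check M.τ (M.eps P i ω - u) :=
  add_sub_cancel (check M.τ (M.eps P i ω)) (check M.τ (M.eps P i ω - u))

variable [MeasurableSpace S] [MeasurableSpace D]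

lemma measurable_excessLoss [IsProbabilityMeasure P] (hM : M.IsFLQR P) :
    Measurable (Function.uncurry (excessLoss M P)) := by
  have h : Measurable fun z : (ℝ × S × D) × ℝ => z.1.1 - M.quantileFun P z.1.2.1 :=
    (measurable_fst.comp measurable_fst).sub ((Model.measurable_quantileFun hM).comp
      (measurable_fst.comp (measurable_snd.comp measurable_fst)))
  exact ((measurable_check _).comp (h.sub measurable_snd)).sub ((measurable_check _).comp h)

lemma measurable_excessLoss_comp [IsProbabilityMeasure P] (hM : M.IsFLQR P)
    {f : ℝ × S × D → ℝ} (hf : Measurable f) : Measurable fun v => excessLoss M P v (f v) := by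
  have h : Measurable fun v : ℝ × S × D => v.1 - M.quantileFun P v.2.1 :=
    measurable_fst.sub ((Model.measurable_quantileFun hM).comp
      (measurable_fst.comp measurable_snd))
  exact ((measurable_check _).comp (h.sub hf)).sub ((measurable_check _).comp h)

lemma abs_excessLoss_sub_le (hM : M.IsFLQR P) (v : ℝ × S × D) (u u' : ℝ) :
    |excessLoss M P v u - excessLoss M P v u'| ≤ |u - u'| := by
  rw [excessLoss, excessLoss, sub_sub_sub_cancel_right]
  refine (abs_check_sub_le hM.tau_pos hM.tau_lt_one _ _).trans (le_of_eq ?_)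
  rw [sub_sub_sub_cancel_left, abs_sub_comm]

variable [IsProbabilityMeasure P]

/-- The risk of the limit prediction, as a lower integral. -/
lemma lintegral_check_limit (hM : M.IsFLQR P) (hL : L.Regular M P 𝒥) {ϱ : ℝ} (hϱ : 0 < ϱ)
    (h2 : ∀ J ∈ 𝒥 n, ∀ᵐ ω ∂P, |L.Q M P n J 0 ω - M.Q P 0 ω| ≤ ϱ)
    {w : 𝒥 n → ℝ} (hw : w ∈ stdSimplex ℝ (𝒥 n)) :
    ∫⁻ ω', ENNReal.ofReal (check M.τ
        (M.Y 0 ω' - ∑ J : 𝒥 n, w J * L.predFun M P n J (M.x 0 ω', M.d 0 ω'))) ∂P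
      = ENNReal.ofReal (∫ ω', check M.τ (M.eps P 0 ω') ∂P + excessRisk M P L 𝒥 ϱ n w) := by
  have h2' : ∀ᵐ ω ∂P, ∀ J ∈ 𝒥 n, |L.Q M P n J 0 ω - M.Q P 0 ω| ≤ ϱ := by
    rw [Filter.eventually_all_finset]
    exact h2
  have hlm : Measurable fun v => ∑ J : 𝒥 n, w J * L.excess M P ϱ n J v :=
    Finset.measurable_sum _ fun J _ => (Limits.measurable_excess hM hL ϱ n J).const_mul _
  have hφm : Measurable fun v => excessLoss M P v (∑ J : 𝒥 n, w J * L.excess M P ϱ n J v) :=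
    measurable_excessLoss_comp hM hlm
  have hφb : ∀ v, |excessLoss M P v (∑ J : 𝒥 n, w J * L.excess M P ϱ n J v)|
      ≤ (∑ J, |w J|) * ϱ := fun v => by
    have := abs_excessLoss_sub_le hM v (∑ J : 𝒥 n, w J * L.excess M P ϱ n J v) 0
    rw [excessLoss_zero, sub_zero, sub_zero] at this
    exact this.trans (abs_linear_le (δ := fun J : 𝒥 n => L.excess M P ϱ n J v)
      fun J => Limits.abs_excess_le hϱ n J v)
  have hφi : Integrable (fun ω' => excessLoss M P (M.unit 0 ω')
      (∑ J : 𝒥 n, w J * L.excess M P ϱ n J (M.unit 0 ω'))) P :=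
    Integrable.of_bound (hφm.comp (Model.measurable_unit hM 0)).aestronglyMeasurable _
      (ae_of_all _ fun ω' => hφb _)
  have hrisk : excessRisk M P L 𝒥 ϱ n w = ∫ ω', excessLoss M P (M.unit 0 ω')
      (∑ J : 𝒥 n, w J * L.excess M P ϱ n J (M.unit 0 ω')) ∂P :=
    integral_map (Model.measurable_unit hM 0).aemeasurable hφm.aestronglyMeasurable
  rw [hrisk, ← integral_add (Model.integrable_check_eps hM) hφi,
    ofReal_integral_eq_lintegral_ofReal (f := fun ω' => check M.τ (M.eps P 0 ω') +
      excessLoss M P (M.unit 0 ω') (∑ J : 𝒥 n, w J * L.excess M P ϱ n J (M.unit 0 ω')))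
      ((Model.integrable_check_eps hM).add hφi)]
  · refine lintegral_congr_ae ?_
    filter_upwards [h2'] with ω' hω'
    rw [sub_sum_predFun_eq hw hω', check_eps_add_excessLoss]
  · refine ae_of_all _ fun ω' => ?_
    dsimp only
    rw [Pi.zero_apply, check_eps_add_excessLoss]
    exact check_nonneg hM.tau_pos hM.tau_lt_one _

/-- The final prediction error differs from the limit risk by at most the expected prediction
error relative to the limit. -/
lemma FPE_close (hM : M.IsFLQR P) (hL : L.Regular M P 𝒥)
    {K : ℕ → ℕ} (hm : m.IsMethod M.I M.τ K) (hc : CloseToLimits M P m L n ω η)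
    {B B' ϱ : ℝ} (hϱ : 0 < ϱ)
    (hB : ∀ J ∈ 𝒥 n, ∫⁻ t in M.I, ‖L.b n J t‖ₑ ≤ ENNReal.ofReal B)
    (hB' : ∫⁻ ω, L.envelope M P 𝒥 n (M.x 0 ω, M.d 0 ω) ∂P ≤ ENNReal.ofReal B')
    (h2 : ∀ J ∈ 𝒥 n, ∀ᵐ ω ∂P, |L.Q M P n J 0 ω - M.Q P 0 ω| ≤ ϱ)
    {w : 𝒥 n → ℝ} (hw : w ∈ stdSimplex ℝ (𝒥 n)) :
    M.FPE P m n ω w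
        ≤ ENNReal.ofReal (∫ ω', check M.τ (M.eps P 0 ω') ∂P + excessRisk M P L 𝒥 ϱ n w)
          + ENNReal.ofReal η * (1 + ENNReal.ofReal B'
            + 2 * (ENNReal.ofReal η * volume M.I) + 2 * ENNReal.ofReal B) ∧
      ENNReal.ofReal (∫ ω', check M.τ (M.eps P 0 ω') ∂P + excessRisk M P L 𝒥 ϱ n w)
        ≤ M.FPE P m n ω w + ENNReal.ofReal η * (1 + ENNReal.ofReal B'
            + 2 * (ENNReal.ofReal η * volume M.I) + 2 * ENNReal.ofReal B) ∧
      ENNReal.ofReal (∫ ω', check M.τ (M.eps P 0 ω') ∂P) ≤ M.FPE P m n ω w := by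
  have hfp := hm.fpca n (M.sample n ω) Finset.univ
  have hxd : Measurable fun ω => (M.x 0 ω, M.d 0 ω) := (hM.x_meas 0).prodMk (hM.d_meas 0)
  have hpredm : ∀ J, Measurable fun z : S × D =>
      m.pred M.I (M.sample n ω) Finset.univ J (M.obsFun n 0 z) := fun J =>
    Estimators.measurable_pred hfp hfp (Model.measurable_score_obsFun hM hfp n 0) J
  have havg : Measurable fun z : S × D =>
      m.avgPred M.I (M.sample n ω) Finset.univ w (M.obsFun n 0 z) :=
    Finset.measurable_sum _ fun J _ => (hpredm J).const_mul _
  set E : ℝ≥0∞ := ENNReal.ofReal η * (1 + ENNReal.ofReal B'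
            + 2 * (ENNReal.ofReal η * volume M.I) + 2 * ENNReal.ofReal B) with hE
  set A : Ω → ℝ := fun ω' => m.avgPred M.I (M.sample n ω) Finset.univ w (M.obs n 0 ω') with hA
  set R : Ω → ℝ := fun ω' => ∑ J : 𝒥 n, w J * L.predFun M P n J (M.x 0 ω', M.d 0 ω') with hR
  have hAJ : ∀ J, Measurable fun ω' =>
      m.pred M.I (M.sample n ω) Finset.univ J (M.obs n 0 ω') := fun J => by
    simp only [Model.obs_eq_obsFun]
    exact (hpredm J).comp hxd
  have hAm : Measurable A := Finset.measurable_sum _ fun J _ => (hAJ J).const_mul _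
  have hRJ : ∀ J, Measurable fun ω' => L.predFun M P n J (M.x 0 ω', M.d 0 ω') := fun J =>
    (Limits.measurable_predFun hM hL n J).comp hxd
  have hRm : Measurable R := Finset.measurable_sum _ fun J _ => (hRJ J).const_mul _
  have hAR : ∫⁻ ω', ‖A ω' - R ω'‖ₑ ∂P ≤ E := by
    refine (lintegral_mono fun ω' => enorm_sum_mul_sub_le hw _ _).trans ?_
    rw [lintegral_finsetSum]
    · refine le_trans (Finset.sum_le_sum fun J _ => le_of_eq ?_)
        (sum_ofReal_mul_le hw fun J => lintegral_enorm_pred_sub_predFun_le hM hL hm hc J.2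
          (hB J J.2) hB')
      rw [lintegral_const_mul' _ _ ENNReal.ofReal_ne_top]
    · exact fun J _ => ((hAJ J).sub (hRJ J)).enorm.const_mul _
  have hcmp : ∀ f g : Ω → ℝ, Measurable f → Measurable g →
      ∫⁻ ω', ENNReal.ofReal (check M.τ (M.Y 0 ω' - f ω')) ∂P
        ≤ ∫⁻ ω', ENNReal.ofReal (check M.τ (M.Y 0 ω' - g ω')) ∂P
          + ∫⁻ ω', ‖f ω' - g ω'‖ₑ ∂P := fun f g hf hg => by
    rw [← lintegral_add_right (g := fun ω' => ‖f ω' - g ω'‖ₑ) _ (hf.sub hg).enorm]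
    refine lintegral_mono fun ω' => ?_
    rw [Real.enorm_eq_ofReal_abs, ← ENNReal.ofReal_add
      (check_nonneg hM.tau_pos hM.tau_lt_one _) (abs_nonneg _)]
    refine ENNReal.ofReal_le_ofReal ?_
    have h := check_le_add hM.tau_pos hM.tau_lt_one (M.Y 0 ω' - f ω') (M.Y 0 ω' - g ω')
    rwa [sub_sub_sub_cancel_left, abs_sub_comm] at h
  have hFPE : M.FPE P m n ω w = ∫⁻ ω', ENNReal.ofReal (check M.τ (M.Y 0 ω' - A ω')) ∂P := rfl
  refine ⟨?_, ?_, ?_⟩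
  · rw [hFPE, ← lintegral_check_limit hM hL hϱ h2 hw]
    exact (hcmp A R hAm hRm).trans (add_le_add_right hAR _)
  · rw [hFPE, ← lintegral_check_limit hM hL hϱ h2 hw]
    refine (hcmp R A hRm hAm).trans (add_le_add_right (le_trans (le_of_eq ?_) hAR) _)
    exact lintegral_congr fun ω' => enorm_sub_rev _ _
  · have h := Model.integral_check_eps_le hM havg
    simpa only [Model.FPE, Model.obs_eq_obsFun] using h

end Risk

/-! ### The cross-validation criterion -/

section CrossValidation

/-- The groups, run through in order, enumerate the first `K ⌊n/K⌋` units. -/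
lemma sum_foldIdx {n K : ℕ} (F : Fin n → ℝ) (h : K * (n / K) ≤ n) :
    ∑ k : Fin K, ∑ i : Fin (n / K), F (foldIdx k i)
      = ∑ i : Fin (K * (n / K)), F (Fin.castLE h i) := by
  rw [← Fintype.sum_prod_type' (f := fun k i => F (foldIdx k i)),
    ← finProdFinEquiv.sum_comp]
  refine Finset.sum_congr rfl fun p _ => congrArg F (Fin.ext ?_)
  simp [foldIdx, finProdFinEquiv]
  ring

/-- The groups cover at least half of the sample. -/
lemma le_two_mul_folds {n K : ℕ} (h2 : 2 ≤ K) (hn : K ≤ n) : n ≤ 2 * (K * (n / K)) := by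
  have h1 : 1 ≤ n / K := (Nat.one_le_div_iff (by omega)).2 hn
  have h3 := Nat.div_add_mod n K
  have h4 := Nat.mod_lt n (show 0 < K by omega)
  have h5 : K * 1 ≤ K * (n / K) := Nat.mul_le_mul_left _ h1
  omega

variable {Ω S D : Type*} {M : Model Ω S D} {𝒥 : ℕ → Finset ℕ} {m : Estimators 𝒥} {n : ℕ} {ω : Ω}

/-- The criterion, rescaled, against the empirical loss of the full-sample predictions. -/
lemma abs_cv_sub_le (h0 : 0 < M.τ) (h1 : M.τ < 1) {K : ℕ} (h : K * (n / K) ≤ n) (hn : 0 < n)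
    {γ : ℝ} (hγ0 : 0 ≤ γ) {w : 𝒥 n → ℝ}
    (hγ : ∀ (k : Fin K) (i : Fin (n / K)),
      |m.avgPred M.I (M.sample n ω) Finset.univ w (M.sample n ω (foldIdx k i)).2
        - m.avgPred M.I (M.sample n ω) (leaveOut n k) w (M.sample n ω (foldIdx k i)).2| ≤ γ) :
    |n * m.cv M.I M.τ K (M.sample n ω) w - ∑ i : Fin (K * (n / K)), check M.τ (M.Y (i + 1) ω
      - m.avgPred M.I (M.sample n ω) Finset.univ w (M.obs n (i + 1) ω))| ≤ n * γ := by
  have hn' : (n : ℝ) ≠ 0 := by exact_mod_cast hn.ne'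
  have hsum := sum_foldIdx (K := K) (fun i : Fin n => check M.τ ((M.sample n ω i).1
    - m.avgPred M.I (M.sample n ω) Finset.univ w (M.sample n ω i).2)) h
  change _ = ∑ i : Fin (K * (n / K)), check M.τ (M.Y (i + 1) ω
      - m.avgPred M.I (M.sample n ω) Finset.univ w (M.obs n (i + 1) ω)) at hsum
  rw [← hsum, Estimators.cv, ← mul_assoc, mul_one_div_cancel hn', one_mul,
    ← Finset.sum_sub_distrib]
  simp only [← Finset.sum_sub_distrib]
  refine (Finset.abs_sum_le_sum_abs _ _).trans ((Finset.sum_le_sum fun k _ =>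
    (Finset.abs_sum_le_sum_abs _ _).trans (Finset.sum_le_sum fun i _ => ?_)).trans
    (b := ∑ _k : Fin K, ∑ _i : Fin (n / K), γ) ?_)
  · refine (abs_check_sub_le h0 h1 _ _).trans ?_
    rw [sub_sub_sub_cancel_left]
    exact hγ k i
  · simp only [Finset.sum_const, Finset.card_univ, Fintype.card_fin, nsmul_eq_mul]
    rw [← mul_assoc]
    refine mul_le_mul_of_nonneg_right ?_ hγ0
    exact_mod_cast h

variable [MeasurableSpace Ω] [MeasurableSpace S] [MeasurableSpace D] {P : Measure Ω}
  [IsProbabilityMeasure P] {L : Limits S D} {η : ℝ}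

/-- The full-sample predictions of the sampled units, summed over the units. -/
lemma sum_abs_avgPred_sub_le (hM : M.IsFLQR P) (hL : L.Regular M P 𝒥)
    {K : ℕ → ℕ} (hm : m.IsMethod M.I M.τ K) (hc : CloseToLimits M P m L n ω η)
    (hη0 : 0 ≤ η) (hη1 : η ≤ 1) {B C : ℝ} (hB0 : 0 ≤ B) (hC0 : 0 ≤ C)
    (hB : ∀ J ∈ 𝒥 n, ∫⁻ t in M.I, ‖L.b n J t‖ₑ ≤ ENNReal.ofReal B)
    (hC : ∑ i : Fin n, L.envelope M P 𝒥 n (M.x (i + 1) ω, M.d (i + 1) ω)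
      ≤ ENNReal.ofReal (C * n))
    {w : 𝒥 n → ℝ} (hw : w ∈ stdSimplex ℝ (𝒥 n)) :
    ∑ i : Fin n, |m.avgPred M.I (M.sample n ω) Finset.univ w (M.obs n (i + 1) ω)
        - ∑ J : 𝒥 n, w J * L.predFun M P n J (M.x (i + 1) ω, M.d (i + 1) ω)|
      ≤ n * (η * (1 + C + 2 * (M.hi - M.lo) + 2 * B)) := by
  have hℓ : 0 ≤ M.hi - M.lo := sub_nonneg.2 hM.lo_lt_hi.le
  have hvol : volume M.I = ENNReal.ofReal (M.hi - M.lo) := Real.volume_Icc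
  rw [← ENNReal.ofReal_le_ofReal_iff (by positivity),
    ENNReal.ofReal_sum_of_nonneg fun i _ => abs_nonneg _]
  have h1 : ∀ i : Fin n, ENNReal.ofReal
      |m.avgPred M.I (M.sample n ω) Finset.univ w (M.obs n (i + 1) ω)
        - ∑ J : 𝒥 n, w J * L.predFun M P n J (M.x (i + 1) ω, M.d (i + 1) ω)|
      ≤ ENNReal.ofReal η * (ENNReal.ofReal (1 + 2 * (M.hi - M.lo) + 2 * B)
        + L.envelope M P 𝒥 n (M.x (i + 1) ω, M.d (i + 1) ω)) := fun i => by
    rw [← Real.enorm_eq_ofReal_abs]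
    refine (enorm_sum_mul_sub_le hw _ _).trans (sum_ofReal_mul_le hw fun J => ?_)
    refine (enorm_pred_sub_predFun_sample_le hM hL hm hc J.2 (hB J J.2) i).trans ?_
    refine mul_le_mul_right ?_ _
    have h2 : 2 * (ENNReal.ofReal η * volume M.I) ≤ ENNReal.ofReal (2 * (M.hi - M.lo)) := by
      rw [hvol, ENNReal.ofReal_mul zero_le_two, ENNReal.ofReal_ofNat]
      refine mul_le_mul_right (mul_le_of_le_one_left' ?_) _
      exact ENNReal.ofReal_le_one.2 hη1
    have h3 : 2 * ENNReal.ofReal B = ENNReal.ofReal (2 * B) := by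
      rw [ENNReal.ofReal_mul zero_le_two, ENNReal.ofReal_ofNat]
    rw [ENNReal.ofReal_add (by positivity) (by positivity),
      ENNReal.ofReal_add (by positivity) (by positivity), ENNReal.ofReal_one, h3]
    refine (add_le_add_left (add_le_add_right h2 _) _).trans (le_of_eq ?_)
    ring
  refine (Finset.sum_le_sum fun i _ => h1 i).trans ?_
  rw [← Finset.mul_sum, Finset.sum_add_distrib, Finset.sum_const, Finset.card_univ,
    Fintype.card_fin, nsmul_eq_mul, ← ENNReal.ofReal_natCast, ← ENNReal.ofReal_mul (by positivity)]
  refine (mul_le_mul_right (add_le_add_right hC _) _).trans (le_of_eq ?_)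
  rw [← ENNReal.ofReal_add (by positivity) (by positivity), ← ENNReal.ofReal_mul hη0]
  congr 1
  ring

end CrossValidation

/-! ### The ratio of prediction errors -/

lemma abs_toReal_div_sub_one_le {x y : ℝ≥0∞} {κ s : ℝ} (hκ : 0 < κ) (hs : 0 ≤ s)
    (hy : ENNReal.ofReal κ ≤ y) (hyt : y ≠ ∞) (hyx : y ≤ x) (hxy : x ≤ y + ENNReal.ofReal s) :
    |(x / y).toReal - 1| ≤ s / κ := by
  have hxt : x ≠ ∞ := ne_top_of_le_ne_top (ENNReal.add_ne_top.2 ⟨hyt, ENNReal.ofReal_ne_top⟩) hxy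
  have hκy : κ ≤ y.toReal := (ENNReal.ofReal_le_iff_le_toReal hyt).1 hy
  have hyx' : y.toReal ≤ x.toReal := ENNReal.toReal_mono hxt hyx
  have hxy' : x.toReal ≤ y.toReal + s := by
    have h := ENNReal.toReal_mono (ENNReal.add_ne_top.2 ⟨hyt, ENNReal.ofReal_ne_top⟩) hxy
    rwa [ENNReal.toReal_add hyt ENNReal.ofReal_ne_top, ENNReal.toReal_ofReal hs] at h
  have hy0 : 0 < y.toReal := hκ.trans_le hκy
  rw [ENNReal.toReal_div, div_sub_one hy0.ne', abs_of_nonneg (by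
    exact div_nonneg (by linarith) hy0.le)]
  exact div_le_div₀ hs (by linarith) hκ hκy

section Ratio

variable {Ω S D : Type*} [MeasurableSpace Ω] [MeasurableSpace S] [MeasurableSpace D]
  {P : Measure Ω} [IsProbabilityMeasure P] {M : Model Ω S D}
  {𝒥 : ℕ → Finset ℕ} {L : Limits S D} {m : Estimators 𝒥} {n : ℕ} {ω : Ω} {η : ℝ}

/-- The bound on the ratio at a sample point at which the estimators are within `η` of their
limits, leaving out a group changes predictions by at most `γ`, and the empirical excess loss
deviates from its expectation by at most `dv`, uniformly over the weights. -/
theorem abs_FPEratio_sub_one_le (hM : M.IsFLQR P) (hL : L.Regular M P 𝒥)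
    {K : ℕ → ℕ} (hK2 : 2 ≤ K n) (hKn : K n ≤ n)
    (hm : m.IsMethod M.I M.τ K) (hc : CloseToLimits M P m L n ω η)
    (hη0 : 0 ≤ η) (hη1 : η ≤ 1) {B B' C ϱ γ dv : ℝ} (hB0 : 0 ≤ B) (hB0' : 0 ≤ B') (hC0 : 0 ≤ C)
    (hϱ : 0 < ϱ) (hγ0 : 0 ≤ γ) (hdv0 : 0 ≤ dv)
    (hB : ∀ J ∈ 𝒥 n, ∫⁻ t in M.I, ‖L.b n J t‖ₑ ≤ ENNReal.ofReal B)
    (hB' : ∫⁻ ω, L.envelope M P 𝒥 n (M.x 0 ω, M.d 0 ω) ∂P ≤ ENNReal.ofReal B')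
    (hC : ∑ i : Fin n, L.envelope M P 𝒥 n (M.x (i + 1) ω, M.d (i + 1) ω)
      ≤ ENNReal.ofReal (C * n))
    (h2 : ∀ J ∈ 𝒥 n, ∀ᵐ ω ∂P, |L.Q M P n J 0 ω - M.Q P 0 ω| ≤ ϱ)
    (h2' : ∀ i : Fin n, ∀ J ∈ 𝒥 n, |L.Q M P n J (i + 1) ω - M.Q P (i + 1) ω| ≤ ϱ)
    (hγ : ∀ w ∈ stdSimplex ℝ (𝒥 n), ∀ (k : Fin (K n)) (i : Fin (n / K n)),
      |m.avgPred M.I (M.sample n ω) Finset.univ w (M.sample n ω (foldIdx k i)).2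
        - m.avgPred M.I (M.sample n ω) (leaveOut n k) w (M.sample n ω (foldIdx k i)).2| ≤ γ)
    (hdv : ∀ w ∈ stdSimplex ℝ (𝒥 n), |∑ i : Fin (K n * (n / K n)),
      (excessLoss M P (M.unit (i + 1) ω) (∑ J : 𝒥 n, w J * L.excess M P ϱ n J (M.unit (i + 1) ω))
        - excessRisk M P L 𝒥 ϱ n w)| ≤ dv) :
    |M.FPEratio P m n ω - 1|
      ≤ (2 * (η * (1 + B' + 2 * (M.hi - M.lo) + 2 * B))
          + 4 * (γ + η * (1 + C + 2 * (M.hi - M.lo) + 2 * B) + dv / n))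
        / ∫ ω', check M.τ (M.eps P 0 ω') ∂P := by
  set κ := ∫ ω', check M.τ (M.eps P 0 ω') ∂P with hκ
  have hκpos : 0 < κ := Model.integral_check_eps_pos hM
  have hℓ : 0 ≤ M.hi - M.lo := sub_nonneg.2 hM.lo_lt_hi.le
  have hvol : volume M.I = ENNReal.ofReal (M.hi - M.lo) := Real.volume_Icc
  set N := K n * (n / K n) with hN
  have hNn : N ≤ n := Nat.mul_div_le n (K n)
  have hnN : n ≤ 2 * N := le_two_mul_folds hK2 hKn
  have hn : 0 < n := by omega
  have hnr : (0 : ℝ) < n := by exact_mod_cast hn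
  have hNr : (n : ℝ) ≤ 2 * N := by exact_mod_cast hnN
  have hNpos : (0 : ℝ) < N := by linarith
  set a₁ := η * (1 + B' + 2 * (M.hi - M.lo) + 2 * B) with ha₁
  set a₂ := γ + η * (1 + C + 2 * (M.hi - M.lo) + 2 * B) + dv / n with ha₂
  have ha₁0 : 0 ≤ a₁ := by positivity
  have ha₂0 : 0 ≤ a₂ := by positivity
  -- prediction error against limit risk
  have hE : ENNReal.ofReal η * (1 + ENNReal.ofReal B'
      + 2 * (ENNReal.ofReal η * volume M.I) + 2 * ENNReal.ofReal B) ≤ ENNReal.ofReal a₁ := by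
    rw [ha₁, ENNReal.ofReal_mul hη0]
    refine mul_le_mul_right ?_ _
    rw [ENNReal.ofReal_add (by positivity) (by positivity),
      ENNReal.ofReal_add (by positivity) (by positivity),
      ENNReal.ofReal_add (by positivity) (by positivity), ENNReal.ofReal_one,
      ENNReal.ofReal_mul zero_le_two, ENNReal.ofReal_mul zero_le_two, ENNReal.ofReal_ofNat, hvol]
    gcongr
    exact mul_le_of_le_one_left' (ENNReal.ofReal_le_one.2 hη1)
  have hF := fun w hw => FPE_close (w := w) hM hL hm hc hϱ hB hB' h2 hw
  -- criterion against limit risk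
  have hV : ∀ w ∈ stdSimplex ℝ (𝒥 n), |n * m.cv M.I M.τ (K n) (M.sample n ω) w
      - (∑ i : Fin N, check M.τ (M.eps P (i + 1) ω) + N * excessRisk M P L 𝒥 ϱ n w)|
      ≤ n * a₂ := by
    intro w hw
    have e1 := abs_cv_sub_le hM.tau_pos hM.tau_lt_one hNn hn hγ0 (hγ w hw)
    have e2 : |∑ i : Fin N, check M.τ (M.Y (i + 1) ω
          - m.avgPred M.I (M.sample n ω) Finset.univ w (M.obs n (i + 1) ω))
        - ∑ i : Fin N, check M.τ (M.Y (i + 1) ω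
          - ∑ J : 𝒥 n, w J * L.predFun M P n J (M.x (i + 1) ω, M.d (i + 1) ω))|
        ≤ n * (η * (1 + C + 2 * (M.hi - M.lo) + 2 * B)) := by
      refine le_trans ?_ (sum_abs_avgPred_sub_le hM hL hm hc hη0 hη1 hB0 hC0 hB hC hw)
      rw [← Finset.sum_sub_distrib]
      refine (Finset.abs_sum_le_sum_abs _ _).trans ?_
      refine (Finset.sum_le_sum (g := fun i : Fin N =>
        |m.avgPred M.I (M.sample n ω) Finset.univ w (M.obs n (i + 1) ω)
          - ∑ J : 𝒥 n, w J * L.predFun M P n J (M.x (i + 1) ω, M.d (i + 1) ω)|)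
        fun i _ => ?_).trans ?_
      · refine (abs_check_sub_le hM.tau_pos hM.tau_lt_one _ _).trans (le_of_eq ?_)
        rw [sub_sub_sub_cancel_left, abs_sub_comm]
      · rw [Fin.sum_univ_eq_sum_range (fun i =>
          |m.avgPred M.I (M.sample n ω) Finset.univ w (M.obs n (i + 1) ω)
            - ∑ J : 𝒥 n, w J * L.predFun M P n J (M.x (i + 1) ω, M.d (i + 1) ω)|) N,
          Fin.sum_univ_eq_sum_range (fun i =>
          |m.avgPred M.I (M.sample n ω) Finset.univ w (M.obs n (i + 1) ω)
            - ∑ J : 𝒥 n, w J * L.predFun M P n J (M.x (i + 1) ω, M.d (i + 1) ω)|) n]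
        exact Finset.sum_le_sum_of_subset_of_nonneg (Finset.range_mono hNn)
          fun _ _ _ => abs_nonneg _
    have e3 : ∑ i : Fin N, check M.τ (M.Y (i + 1) ω
          - ∑ J : 𝒥 n, w J * L.predFun M P n J (M.x (i + 1) ω, M.d (i + 1) ω))
        = ∑ i : Fin N, check M.τ (M.eps P (i + 1) ω) + ∑ i : Fin N,
          excessLoss M P (M.unit (i + 1) ω)
            (∑ J : 𝒥 n, w J * L.excess M P ϱ n J (M.unit (i + 1) ω)) := by
      rw [← Finset.sum_add_distrib]
      refine Finset.sum_congr rfl fun i _ => ?_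
      have h : ∀ J ∈ 𝒥 n, |L.Q M P n J (i + 1) ω - M.Q P (i + 1) ω| ≤ ϱ :=
        h2' (Fin.castLE hNn i)
      rw [sub_sum_predFun_eq hw h, check_eps_add_excessLoss]
    have e4 := hdv w hw
    rw [Finset.sum_sub_distrib, Finset.sum_const, Finset.card_univ, Fintype.card_fin,
      nsmul_eq_mul] at e4
    have e5 : n * a₂ = n * γ + n * (η * (1 + C + 2 * (M.hi - M.lo) + 2 * B)) + dv := by
      rw [ha₂]
      field_simp
    rw [e3] at e2
    rw [e5]
    rw [abs_le] at *
    constructor <;> linarith [e1.1, e1.2, e2.1, e2.2, e4.1, e4.2]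
  -- the selected weights against an arbitrary competitor
  have hwm := hm.weight_mem n (M.sample n ω)
  set ŵ := m.weight n (M.sample n ω) with hŵ
  have hmin : ∀ w ∈ stdSimplex ℝ (𝒥 n), M.FPE P m n ω ŵ
      ≤ M.FPE P m n ω w + ENNReal.ofReal (2 * a₁ + 4 * a₂) := by
    intro w hw
    have c1 := hm.weight_min n (M.sample n ω) w hw
    have c2 := (abs_le.1 (hV ŵ hwm)).1
    have c3 := (abs_le.1 (hV w hw)).2
    have c4 : n * m.cv M.I M.τ (K n) (M.sample n ω) ŵ
        ≤ n * m.cv M.I M.τ (K n) (M.sample n ω) w := mul_le_mul_of_nonneg_left c1 hnr.le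
    have c5 : N * (excessRisk M P L 𝒥 ϱ n ŵ - excessRisk M P L 𝒥 ϱ n w) ≤ N * (4 * a₂) := by
      have : (n : ℝ) * a₂ ≤ 2 * N * a₂ := mul_le_mul_of_nonneg_right hNr ha₂0
      linarith
    have c6 := le_of_mul_le_mul_left c5 hNpos
    calc M.FPE P m n ω ŵ
        ≤ ENNReal.ofReal (κ + excessRisk M P L 𝒥 ϱ n ŵ) + ENNReal.ofReal a₁ :=
          (hF ŵ hwm).1.trans (add_le_add_right hE _)
      _ ≤ ENNReal.ofReal ((κ + excessRisk M P L 𝒥 ϱ n w) + 4 * a₂) + ENNReal.ofReal a₁ := by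
          exact add_le_add_left (ENNReal.ofReal_le_ofReal (by linarith)) _
      _ ≤ ENNReal.ofReal (κ + excessRisk M P L 𝒥 ϱ n w) + ENNReal.ofReal (4 * a₂)
          + ENNReal.ofReal a₁ := by
          gcongr
          exact ENNReal.ofReal_add_le
      _ ≤ M.FPE P m n ω w + ENNReal.ofReal a₁ + ENNReal.ofReal (4 * a₂)
          + ENNReal.ofReal a₁ := by
          gcongr
          exact (hF w hw).2.1.trans (add_le_add_right hE _)
      _ = _ := by
          rw [add_assoc, add_assoc, ← ENNReal.ofReal_add (by positivity) ha₁0,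
            ← ENNReal.ofReal_add ha₁0 (by positivity)]
          congr 2
          ring
  refine abs_toReal_div_sub_one_le hκpos (by positivity) ?_ ?_ (iInf₂_le ŵ hwm) ?_
  · exact le_iInf₂ fun w hw => (hF w hw).2.2
  · refine ne_top_of_le_ne_top ?_ (iInf₂_le ŵ hwm)
    exact ne_top_of_le_ne_top (ENNReal.add_ne_top.2 ⟨ENNReal.ofReal_ne_top, ENNReal.ofReal_ne_top⟩)
      ((hF ŵ hwm).1.trans (add_le_add_right hE _))
  · rw [← tsub_le_iff_right]
    exact le_iInf₂ fun w hw => tsub_le_iff_right.2 (hmin w hw)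

end Ratio

/-! ### Events of large probability -/

section Events

variable {Ω : Type*} [MeasurableSpace Ω] {P : Measure Ω}

lemma measure_not_and_le {p q : Ω → Prop} {a b : ℝ} (ha : 0 ≤ a) (hb : 0 ≤ b)
    (hp : P {ω | ¬p ω} ≤ ENNReal.ofReal a) (hq : P {ω | ¬q ω} ≤ ENNReal.ofReal b) :
    P {ω | ¬(p ω ∧ q ω)} ≤ ENNReal.ofReal (a + b) := by
  rw [ENNReal.ofReal_add ha hb]
  refine le_trans (measure_mono ?_) ((measure_union_le _ _).trans (add_le_add hp hq))
  intro ω hω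
  by_cases h : p ω
  · exact Or.inr fun h' => hω ⟨h, h'⟩
  · exact Or.inl h

/-- A uniform stochastic bound, with the constant enlarged, as a bound on the complement of the
event where it holds. -/
lemma measure_not_forall_le {E : Type*} [ENorm E] {ι : Type*} {Z : ι → Ω → E} {r C C' : ℝ}
    {a : ℝ≥0∞} (hr : 0 ≤ r) (hC : C ≤ C')
    (h : P {ω | ∃ i, ENNReal.ofReal (C * r) < ‖Z i ω‖ₑ} ≤ a) :
    P {ω | ¬∀ i, ‖Z i ω‖ₑ ≤ ENNReal.ofReal (C' * r)} ≤ a := by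
  refine (measure_mono fun ω hω => ?_).trans h
  obtain ⟨i, hi⟩ := not_forall.1 hω
  exact ⟨i, (ENNReal.ofReal_le_ofReal (mul_le_mul_of_nonneg_right hC hr)).trans_lt (not_le.1 hi)⟩

lemma BigOp.tendstoInMeasure {Z : ℕ → Ω → ℝ} {a : ℝ} {r : ℕ → ℝ}
    (h : BigOp P (fun n ω => Z n ω - a) r) (hr : Tendsto r atTop (𝓝 0)) :
    TendstoInMeasure P Z atTop fun _ => a := by
  refine tendstoInMeasure_of_ne_top fun e he het => ENNReal.tendsto_nhds_zero.2 fun δ hδ => ?_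
  obtain ⟨δ', hδ'0, hδ'⟩ : ∃ δ' : ℝ, 0 < δ' ∧ ENNReal.ofReal δ' ≤ δ := by
    rcases eq_or_ne δ ∞ with rfl | hδt
    · exact ⟨1, one_pos, le_top⟩
    · exact ⟨δ.toReal, ENNReal.toReal_pos hδ.ne' hδt, (ENNReal.ofReal_toReal hδt).le⟩
  obtain ⟨C, hC, hev⟩ := h δ' hδ'0
  have hCr : ∀ᶠ n in atTop, C * r n < e.toReal := by
    have : Tendsto (fun n => C * r n) atTop (𝓝 (C * 0)) := hr.const_mul C
    rw [mul_zero] at this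
    exact this.eventually_lt_const (ENNReal.toReal_pos he.ne' het)
  filter_upwards [hev, hCr] with n h1 h2
  refine le_trans (measure_mono fun ω hω => ?_) (h1.trans hδ')
  refine ⟨(), lt_of_lt_of_le ?_ (le_of_le_of_eq hω (edist_eq_enorm_sub _ _))⟩
  rw [← ENNReal.ofReal_toReal het]
  exact (ENNReal.ofReal_lt_ofReal_iff (ENNReal.toReal_pos he.ne' het)).2 h2

end Events

section Probability

variable {Ω S D : Type*} [MeasurableSpace Ω] [MeasurableSpace S] [MeasurableSpace D]
  {P : Measure Ω} [IsProbabilityMeasure P] {M : Model Ω S D}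
  {𝒥 : ℕ → Finset ℕ} {L : Limits S D} {n : ℕ}

/-- Markov's inequality for the sum of the envelopes of the sampled units. -/
lemma measure_sum_envelope_le (hM : M.IsFLQR P) (hL : L.Regular M P 𝒥) (hn : 0 < n) {B' e : ℝ}
    (hB0 : 0 ≤ B') (he : 0 < e)
    (hB' : ∫⁻ ω, L.envelope M P 𝒥 n (M.x 0 ω, M.d 0 ω) ∂P ≤ ENNReal.ofReal B') :
    P {ω | ¬∑ i : Fin n, L.envelope M P 𝒥 n (M.x (i + 1) ω, M.d (i + 1) ω)
      ≤ ENNReal.ofReal ((B' + 1) / e * n)} ≤ ENNReal.ofReal e := by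
  have hn' : (0 : ℝ) < n := by exact_mod_cast hn
  have hm : ∀ i, Measurable fun ω => L.envelope M P 𝒥 n (M.x i ω, M.d i ω) := fun i =>
    (Limits.measurable_envelope hM hL n).comp ((hM.x_meas i).prodMk (hM.d_meas i))
  have hint : ∫⁻ ω, ∑ i : Fin n, L.envelope M P 𝒥 n (M.x (i + 1) ω, M.d (i + 1) ω) ∂P
      ≤ ENNReal.ofReal (n * B') := by
    rw [lintegral_finsetSum _ fun (i : Fin n) _ => hm (i + 1)]
    refine (Finset.sum_le_sum fun (i : Fin n) _ =>
      (Limits.lintegral_envelope hM hL n (i + 1)).le.trans hB').trans (le_of_eq ?_)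
    rw [Finset.sum_const, Finset.card_univ, Fintype.card_fin, nsmul_eq_mul,
      ENNReal.ofReal_mul hn'.le, ENNReal.ofReal_natCast]
  have hpos : 0 < (B' + 1) / e * n := by positivity
  refine (measure_mono fun ω hω => (not_le.1 hω).le).trans
    ((meas_ge_le_lintegral_div (Finset.measurable_sum _ fun (i : Fin n) _ => hm (i + 1)).aemeasurable
      (ENNReal.ofReal_pos.2 hpos).ne' ENNReal.ofReal_ne_top).trans ?_)
  refine (ENNReal.div_le_div_right hint _).trans ?_
  rw [← ENNReal.ofReal_div_of_pos hpos]
  refine ENNReal.ofReal_le_ofReal ?_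
  rw [div_le_iff₀ hpos]
  have : e * ((B' + 1) / e * n) = n * B' + n := by field_simp
  rw [this]
  linarith

/-- Uniform deviations of the empirical excess loss over the grouped units. -/
lemma measure_excessLoss_deviation_le (hM : M.IsFLQR P) (hL : L.Regular M P 𝒥)
    (h𝒥 : (𝒥 n).Nonempty) {N : ℕ} (hN : 0 < N) (hNn : N ≤ n) {ϱ e : ℝ} (hϱ : 0 < ϱ) (he : 0 < e) :
    P {ω | ¬∀ w ∈ stdSimplex ℝ (𝒥 n), |∑ i : Fin N,
      (excessLoss M P (M.unit (i + 1) ω) (∑ J : 𝒥 n, w J * L.excess M P ϱ n J (M.unit (i + 1) ω))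
        - excessRisk M P L 𝒥 ϱ n w)| ≤ 8 * ϱ / e * √(n * (𝒥 n).card)} ≤ ENNReal.ofReal e := by
  have : Nonempty (𝒥 n) := h𝒥.to_subtype
  have hNr : (0 : ℝ) < N := by exact_mod_cast hN
  have hnr : (N : ℝ) ≤ n := by exact_mod_cast hNn
  have hn0 : (0 : ℝ) < n := hNr.trans_le hnr
  have hp : (0 : ℝ) < (𝒥 n).card := by exact_mod_cast h𝒥.card_pos
  have hpos : 0 < √(n * (𝒥 n).card : ℝ) := Real.sqrt_pos.2 (by positivity)
  have : IsProbabilityMeasure (P.map (M.unit 0)) :=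
    Measure.isProbabilityMeasure_map (Model.measurable_unit hM 0).aemeasurable
  have key := measure_exists_simplex_le P (P.map (M.unit 0)) (ι := 𝒥 n) hN
    (X := fun (i : Fin N) => M.unit (i + 1)) (fun i => Model.measurable_unit hM _)
    (Model.map_units hM N) (δ := fun J => L.excess M P ϱ n J)
    (fun J => Limits.measurable_excess hM hL ϱ n J) hϱ
    (fun J v => Limits.abs_excess_le hϱ n J v) (φ := excessLoss M P) (measurable_excessLoss hM)
    excessLoss_zero (abs_excessLoss_sub_le hM) (x := 4 * ϱ / e * √(n * (𝒥 n).card))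
    (mul_pos (by positivity) hpos)
  refine (measure_mono fun ω hω => ?_).trans (key.trans (ENNReal.ofReal_le_ofReal ?_))
  · obtain ⟨w, hw⟩ := not_forall.1 hω
    obtain ⟨hw, hwx⟩ := Classical.not_imp.1 hw
    refine ⟨w, hw, lt_of_le_of_lt (le_of_eq ?_) (not_le.1 hwx)⟩
    ring
  · rw [Fintype.card_coe, div_le_iff₀ (mul_pos (by positivity) hpos)]
    have h1 : √(N * (𝒥 n).card : ℝ) ≤ √(n * (𝒥 n).card) :=
      Real.sqrt_le_sqrt (mul_le_mul_of_nonneg_right hnr hp.le)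
    have h2 : e * (4 * ϱ / e * √(n * (𝒥 n).card)) = 4 * ϱ * √(n * (𝒥 n).card) := by field_simp
    rw [h2]
    exact mul_le_mul_of_nonneg_left h1 (by positivity)

/-- The deviation bound, divided by the sample size, is the rate `n^{-1/2} p^{1/2}`. -/
lemma sqrt_mul_div_eq (n p : ℕ) :
    √((n : ℝ) * p) / n = (n : ℝ) ^ (-(1 / 2) : ℝ) * (p : ℝ) ^ (1 / 2 : ℝ) := by
  rw [Real.sqrt_mul (Nat.cast_nonneg n), Real.rpow_neg (Nat.cast_nonneg n), ← Real.sqrt_eq_rpow,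
    ← Real.sqrt_eq_rpow, mul_div_right_comm, Real.sqrt_div_self']
  ring

end Probability

end FLQR

theorem corollary1 {Ω S D : Type*} [MeasurableSpace Ω] [MeasurableSpace S] [MeasurableSpace D]
    (P : Measure Ω) [IsProbabilityMeasure P]
    (M : FLQR.Model Ω S D) (hM : M.IsFLQR P)
    (𝒥 : ℕ → Finset ℕ) (h𝒥 : ∀ n, (𝒥 n).Nonempty)
    (h𝒥n : Tendsto (fun n : ℕ => ((𝒥 n).card : ℝ) / n) atTop (𝓝 0))
    (K : ℕ → ℕ) (hK : ∀ᶠ n in atTop, 2 ≤ K n ∧ K n ≤ n)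
    (m : FLQR.Estimators 𝒥) (hm : m.IsMethod M.I M.τ K)
    (L : FLQR.Limits S D) (hL : L.Regular M P 𝒥)
    (c g : ℕ → ℝ)
    (h1 : FLQR.Condition1 M P m L c)
    (h2 : FLQR.Condition2 M P 𝒥 L)
    (h3 : FLQR.Condition3 M P m K g) :
    FLQR.BigOp P (fun n ω => M.FPEratio P m n ω - 1)
        (fun n => c n + g n + (n : ℝ) ^ (-(1 / 2) : ℝ) * ((𝒥 n).card : ℝ) ^ (1 / 2 : ℝ)) ∧
      TendstoInMeasure P (fun n ω => M.FPEratio P m n ω) atTop (fun _ => (1 : ℝ)) := by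
  have hr : Tendsto (fun n : ℕ => c n + g n
      + (n : ℝ) ^ (-(1 / 2) : ℝ) * ((𝒥 n).card : ℝ) ^ (1 / 2 : ℝ)) atTop (𝓝 0) := by
    have h : Tendsto (fun n : ℕ => (((𝒥 n).card : ℝ) / n) ^ (1 / 2 : ℝ)) atTop (𝓝 0) := by
      have := h𝒥n.rpow_const (p := (1 / 2 : ℝ)) (Or.inr (by norm_num))
      rwa [Real.zero_rpow (by norm_num)] at this
    have h' := (h1.rate_tendsto.add h3.rate_tendsto).add h
    simp only [add_zero] at h'
    refine h'.congr fun n => ?_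
    rw [Real.div_rpow (Nat.cast_nonneg _) (Nat.cast_nonneg _), Real.rpow_neg (Nat.cast_nonneg _),
      div_eq_inv_mul]
  suffices hB : FLQR.BigOp P (fun n ω => M.FPEratio P m n ω - 1)
      (fun n => c n + g n + (n : ℝ) ^ (-(1 / 2) : ℝ) * ((𝒥 n).card : ℝ) ^ (1 / 2 : ℝ)) from
    ⟨hB, hB.tendstoInMeasure hr⟩
  intro ε hε
  -- eight events of small probability are excluded: six from the stochastic bounds, one from
  -- Markov's inequality for the envelopes, one from the empirical process
  set e := ε / 8 with he
  have hepos : 0 < e := by positivity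
  obtain ⟨ϱ, hϱ, h2⟩ := h2
  obtain ⟨B₀, hB₀⟩ := hL.b_bound
  obtain ⟨B₁, hB₁⟩ := hL.X_bound
  obtain ⟨C₁, hC₁, ev₁⟩ := h1.icept e hepos
  obtain ⟨C₂, hC₂, ev₂⟩ := h1.slope e hepos
  obtain ⟨C₃, hC₃, ev₃⟩ := h1.mean e hepos
  obtain ⟨C₄, hC₄, ev₄⟩ := h1.curve e hepos
  obtain ⟨C₅, hC₅, ev₅⟩ := h1.curve_new e hepos
  obtain ⟨C₆, hC₆, ev₆⟩ := h3.diff e hepos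
  set B := max B₀ 0 with hB
  set B' := max B₁ 0 with hB'
  have hB0 : 0 ≤ B := le_max_right _ _
  have hB'0 : 0 ≤ B' := le_max_right _ _
  set Cc := C₁ + C₂ + C₃ + C₄ + C₅ with hCc
  have hCc0 : 0 < Cc := by positivity
  set κ := ∫ ω, FLQR.check M.τ (M.eps P 0 ω) ∂P with hκ
  have hκ0 : 0 < κ := FLQR.Model.integral_check_eps_pos hM
  have hℓ : 0 ≤ M.hi - M.lo := sub_nonneg.2 hM.lo_lt_hi.le
  set A₁ := 1 + B' + 2 * (M.hi - M.lo) + 2 * B with hA₁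
  set Ce := (B' + 1) / e with hCe
  set A₂ := 1 + Ce + 2 * (M.hi - M.lo) + 2 * B with hA₂
  set Cd := 8 * ϱ / e with hCd
  have hCe0 : 0 ≤ Ce := by positivity
  refine ⟨(2 * (Cc * A₁) + 4 * (C₆ + Cc * A₂ + Cd)) / κ, by positivity, ?_⟩
  -- `η ≤ 1` turns the terms of order `η²` in the bounds into terms of order `η`
  have hsmall : ∀ᶠ n in atTop, Cc * c n < 1 := by
    have : Tendsto (fun n => Cc * c n) atTop (𝓝 (Cc * 0)) := h1.rate_tendsto.const_mul Cc
    rw [mul_zero] at this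
    exact this.eventually_lt_const one_pos
  filter_upwards [hK, hsmall, hB₀, hB₁, ev₁, ev₂, ev₃, ev₄, ev₅, ev₆] with n hKn hη1 hb hx
    e₁ e₂ e₃ e₄ e₅ e₆
  have hc0 := h1.rate_nonneg n
  have hg0 := h3.rate_nonneg n
  have hb' : ∀ J ∈ 𝒥 n, ∫⁻ t in M.I, ‖L.b n J t‖ₑ ≤ ENNReal.ofReal B := fun J hJ =>
    (hb J hJ).trans (ENNReal.ofReal_le_ofReal (le_max_left _ _))
  have hx' : ∫⁻ ω, L.envelope M P 𝒥 n (M.x 0 ω, M.d 0 ω) ∂P ≤ ENNReal.ofReal B' :=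
    le_trans hx (ENNReal.ofReal_le_ofReal (le_max_left _ _))
  have hnN := FLQR.le_two_mul_folds hKn.1 hKn.2
  have hNn : K n * (n / K n) ≤ n := Nat.mul_div_le n (K n)
  have hN0 : 0 < K n * (n / K n) := by omega
  have hn : 0 < n := by omega
  have hcond : ∀ᵐ ω ∂P, ∀ i : Fin n, ∀ J ∈ 𝒥 n,
      |L.Q M P n J (i + 1) ω - M.Q P (i + 1) ω| ≤ ϱ := by
    refine ae_all_iff.2 fun i => ?_
    rw [Filter.eventually_all_finset]
    exact fun J hJ => h2 n (i + 1) i.2 J hJ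
  have f₁ := FLQR.measure_not_forall_le (C' := Cc) hc0 (by linarith) e₁
  have f₂ := FLQR.measure_not_forall_le (C' := Cc) hc0 (by linarith) e₂
  have f₃ := FLQR.measure_not_forall_le (C' := Cc) hc0 (by linarith) e₃
  have f₄ := FLQR.measure_not_forall_le (C' := Cc) hc0 (by linarith) e₄
  have f₅ := FLQR.measure_not_forall_le (C' := Cc) hc0 (by linarith) e₅
  have f₆ := FLQR.measure_not_forall_le (C' := C₆) hg0 le_rfl e₆
  have f₇ := FLQR.measure_sum_envelope_le hM hL hn hB'0 hepos hx'
  have f₈ := FLQR.measure_excessLoss_deviation_le hM hL (h𝒥 n) hN0 hNn hϱ hepos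
  have f₉ : P {ω | ¬∀ i : Fin n, ∀ J ∈ 𝒥 n, |L.Q M P n J (i + 1) ω - M.Q P (i + 1) ω| ≤ ϱ}
      ≤ ENNReal.ofReal 0 := by
    rw [ae_iff.1 hcond]
    exact zero_le
  have hall := FLQR.measure_not_and_le hepos.le (by positivity) f₁ <|
    FLQR.measure_not_and_le hepos.le (by positivity) f₂ <|
    FLQR.measure_not_and_le hepos.le (by positivity) f₃ <|
    FLQR.measure_not_and_le hepos.le (by positivity) f₄ <|
    FLQR.measure_not_and_le hepos.le (by positivity) f₅ <|
    FLQR.measure_not_and_le hepos.le (by positivity) f₆ <|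
    FLQR.measure_not_and_le hepos.le (by positivity) f₇ <|
    FLQR.measure_not_and_le hepos.le le_rfl f₈ f₉
  have hsum : e + (e + (e + (e + (e + (e + (e + (e + 0))))))) = ε := by rw [he]; ring
  rw [hsum] at hall
  refine (measure_mono ?_).trans hall
  rintro ω ⟨-, hω⟩ ⟨g₁, g₂, g₃, g₄, g₅, g₆, g₇, g₈, g₉⟩
  refine absurd hω (not_lt.2 ?_)
  rw [Real.enorm_eq_ofReal_abs]
  refine ENNReal.ofReal_le_ofReal ?_
  have hclose : FLQR.CloseToLimits M P m L n ω (Cc * c n) :=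
    ⟨fun J hJ => g₁ ⟨J, hJ⟩, fun J hJ t ht => g₂ (⟨J, hJ⟩, ⟨t, ht⟩), fun t ht => g₃ ⟨t, ht⟩,
      fun J hJ t ht i => g₄ (⟨J, hJ⟩, ⟨t, ht⟩, i), fun J hJ t ht => g₅ (⟨J, hJ⟩, ⟨t, ht⟩)⟩
  have hfold : ∀ w ∈ stdSimplex ℝ (𝒥 n), ∀ (k : Fin (K n)) (i : Fin (n / K n)),
      |m.avgPred M.I (M.sample n ω) Finset.univ w (M.sample n ω (FLQR.foldIdx k i)).2
        - m.avgPred M.I (M.sample n ω) (FLQR.leaveOut n k) w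
          (M.sample n ω (FLQR.foldIdx k i)).2| ≤ C₆ * g n := fun w hw k i => by
    have h := g₆ (⟨w, hw⟩, k, i)
    rwa [Real.enorm_eq_ofReal_abs, ENNReal.ofReal_le_ofReal_iff (by positivity)] at h
  have hfinal := FLQR.abs_FPEratio_sub_one_le hM hL hKn.1 hKn.2 hm hclose (by positivity) hη1.le
    hB0 hB'0 hCe0 hϱ (by positivity) (by positivity) hb' hx' g₇ (fun J hJ => h2 n 0 n.zero_le J hJ)
    g₉ hfold g₈
  refine hfinal.trans ?_
  refine le_trans ?_ (le_of_eq (div_mul_eq_mul_div _ κ _).symm)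
  refine div_le_div_of_nonneg_right ?_ hκ0.le
  rw [mul_div_assoc (8 * ϱ / e), FLQR.sqrt_mul_div_eq, ← hCd, ← hA₁, ← hA₂]
  set s := (n : ℝ) ^ (-(1 / 2) : ℝ) * ((𝒥 n).card : ℝ) ^ (1 / 2 : ℝ) with hs
  have hs0 : 0 ≤ s := by positivity
  have hA₁0 : 0 ≤ A₁ := by positivity
  have hA₂0 : 0 ≤ A₂ := by positivity
  have hCd0 : 0 ≤ Cd := by positivity
  have t₁ : Cc * A₁ * c n ≤ Cc * A₁ * (c n + g n + s) := by gcongr; linarith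
  have t₂ : Cc * A₂ * c n ≤ Cc * A₂ * (c n + g n + s) := by gcongr; linarith
  have t₃ : C₆ * g n ≤ C₆ * (c n + g n + s) := by gcongr; linarith
  have t₄ : Cd * s ≤ Cd * (c n + g n + s) := by gcongr; linarith
  linarith
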